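/- Let $K \subset \mathbb{R}^3$ be a Legendrian knot for the contact structure $\ker(dz - y\,dx)$ whose front projection to the $xz$-plane is generic, with all crossings and cusps at distinct $x$-coordinates. A \emph{normal ruling} of a front in $\mathbb{R}^2$ or $S^1 \times \mathbb{R}$ is a choice, continuous in $x$ away from crossings and cusps, of a fixed-point free involution of the strands over $x$, such that: the two branches of a cusp are paired near the cusp, and the pairing of the other strands does not change there; two strands meeting at a crossing are not paired; at each crossing the involution extends continuously either along the two crossing strands, or along the upper and the lower half of the crossing (the crossing is then called a \emph{switch}); and near a switch the two vertical intervals joining the switching strands to their companions are disjoint or nested. The (ungraded) ruling polynomial is $$R(z) = \sum_{\rho} z^{\,j(\rho)}, \qquad j(\rho) = \#\text{switches of } \rho - \#\text{right cusps},$$ where $\rho$ runs over all normal rulings. Let $A_{(2)} = A_2 \subset J^1(S^1)$ be the Legendrian knot whose front in $S^1 \times \mathbb{R}$ is the closure of the $2$-stranded braid $\sigma_1$ with a single crossing. The satellite $S(K, A_{(2)})$ is obtained from the front of $K$ by taking two copies, one shifted slightly downward from the other, and inserting the front of $A_{(2)}$ (one extra crossing) into the two parallel strands at a base point of $K$ away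 from crossings and cusps. \textbf{Theorem.} If $\deg R_K(z) \geq 0$ (that is, if $K$ has a normal ruling in which the number of switches is at least the number of right cusps), then $K$ is $A_{(2)}$-compatible: for every choice of the base point, $$R_{S(K, A_{(2)})}(z) \neq R_{A_{(2)}}(z).$$ -/

import Mathlib

/-!
Fronts are recorded by the sequence, from left to right, of their cusps and crossings, which are
assumed to have pairwise distinct `x`-coordinates.  Strands over a given `x` are numbered
`0, 1, 2, …` from top to bottom.
-/

namespace LegendrianFront

/-- A singularity of a generic front.  The argument is the number of strands above it, so that the
two strands involved have numbers `k` and `k + 1`. -/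
inductive Event where
  | leftCusp (k : ℕ)
  | rightCusp (k : ℕ)
  | crossing (k : ℕ)

namespace Event

/-- The event can occur in a front having `n` strands immediately to the left of it. -/
def Fits : Event → ℕ → Prop
  | leftCusp k, n => k ≤ n
  | rightCusp k, n => k + 2 ≤ n
  | crossing k, n => k + 2 ≤ n

/-- Number of strands to the right of the event, given the number `n` to the left of it. -/
def out : Event → ℕ → ℕ
  | leftCusp _, n => n + 2
  | rightCusp _, n => n - 2
  | crossing _, n => n

/-- The same event with `d` further strands above it. -/
def shift (d : ℕ) : Event → Event
  | leftCusp k => leftCusp (d + k)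
  | rightCusp k => rightCusp (d + k)
  | crossing k => crossing (d + k)

/-- Reflection across a vertical axis. -/
def reflect : Event → Event
  | leftCusp k => rightCusp k
  | rightCusp k => leftCusp k
  | crossing k => crossing k

/-- The `N`-copy of a left cusp: `N` left cusps on top of each other, followed by the crossings of
the lower branch of the `i`-th with the upper branch of the `j`-th cusp for all `i < j`.
For each `j`, the upper branch of the `j`-th cusp moves up from place `2 * j` to place `j`. -/
def copyLeftCusp (N k : ℕ) : List Event :=
  (List.range N).map (fun j => leftCusp (N * k + 2 * j)) ++
    (List.range N).flatMap fun j =>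
      (List.range j).reverse.map fun t => crossing (N * k + j + t)

/-- The `N`-copy of a crossing: each of `N` parallel strands crosses each of `N` other ones.
For each `j`, the `j`-th strand of the lower group moves up from place `N + j` to place `j`. -/
def copyCrossing (N k : ℕ) : List Event :=
  (List.range N).flatMap fun j =>
    (List.range N).reverse.map fun t => crossing (N * k + j + t)

/-- The events in the `N`-copy of a front that arise from one event of the front. -/
def copy (N : ℕ) : Event → List Event
  | leftCusp k => copyLeftCusp N k
  | rightCusp k => ((copyLeftCusp N k).map reflect).reverse
  | crossing k => copyCrossing N k

end Event

open Event

/-- Number of strands to the right of a sequence of events, with `n` strands to the left of it. -/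
def strandsAfter (n : ℕ) (l : List Event) : ℕ := l.foldl (fun m e => e.out m) n

/-- The sequence of events describes a front over an interval, with `n` strands at the left end
and `m` strands at the right end. -/
def IsTangle : ℕ → List Event → ℕ → Prop
  | n, [], m => n = m
  | n, e :: l, m => e.Fits n ∧ IsTangle (e.out n) l m

/-- A generic front in the annulus `S¹ × ℝ`, cut open at `x = 0`, where it has `n` strands.
For `n = 0` this is the same as a generic front in the plane. -/
structure Front (n : ℕ) where
  events : List Event
  closed : IsTangle n events n

/-- The number of strands over the `g`-th gap, which lies between the first `g` events and the
remaining ones. -/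
def Front.width {n : ℕ} (F : Front n) (g : ℕ) : ℕ := strandsAfter n (F.events.take g)

/-- The basic front `A_k`: the closure of the `k`-stranded braid `σ₁ σ₂ ⋯ σ_{k-1}`. -/
def basicFront (k : ℕ) : Front k where
  events := (List.range (k - 1)).map crossing
  closed := by
    have h : ∀ l : List ℕ, (∀ i ∈ l, i + 2 ≤ k) → IsTangle k (l.map crossing) k := by
      intro l
      induction l with
      | nil => intro _; rfl
      | cons a l ih =>
        intro hl
        exact ⟨hl a (by simp), ih fun i hi => hl i (by simp [hi])⟩
    exact h _ fun i hi => by have := List.mem_range.1 hi; omega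

/-! ### Normal rulings -/

/-- `p` is a fixed point free involution of the strands `0, …, n - 1`
(extended by the identity to all natural numbers). -/
def IsPairing (n : ℕ) (p : ℕ → ℕ) : Prop :=
  (∀ i < n, p i < n ∧ p i ≠ i ∧ p (p i) = i) ∧ ∀ i, n ≤ i → p i = i

/-- The numbering of the strands not meeting a cusp at place `k`, on the side of its branches. -/
def skip (k i : ℕ) : ℕ := if i < k then i else i + 2

/-- The normality condition at a switch between the strands `k` and `k + 1`: the vertical intervals
joining them to their companions are disjoint or one contains the other. -/
def IsNormal (k : ℕ) (p : ℕ → ℕ) : Prop :=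
  Disjoint (Set.uIcc k (p k)) (Set.uIcc (k + 1) (p (k + 1))) ∨
    Set.uIcc k (p k) ⊆ Set.uIcc (k + 1) (p (k + 1)) ∨
    Set.uIcc (k + 1) (p (k + 1)) ⊆ Set.uIcc k (p k)

/-- The pairings `p` to the left and `q` to the right of an event are compatible with it.
At a crossing, the two meeting strands are not paired, and either they are followed through the
crossing, or the crossing is a switch and satisfies the normality condition. -/
def Passes : Event → (ℕ → ℕ) → (ℕ → ℕ) → Prop
  | leftCusp k, p, q => q k = k + 1 ∧ ∀ i, q (skip k i) = skip k (p i)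
  | rightCusp k, p, q => p k = k + 1 ∧ ∀ i, p (skip k i) = skip k (q i)
  | crossing k, p, q => p k ≠ k + 1 ∧
      ((∀ i, q (Equiv.swap k (k + 1) i) = Equiv.swap k (k + 1) (p i)) ∨ (q = p ∧ IsNormal k p))

namespace Front

variable {n : ℕ}

/-- A normal ruling of a front: an involution of the strands over each gap.  The first and the
last gap are the two sides of `x = 0`, where the involutions agree. -/
def IsNormalRuling (F : Front n) (ρ : Fin (F.events.length + 1) → ℕ → ℕ) : Prop :=
  (∀ g : Fin (F.events.length + 1), IsPairing (F.width g) (ρ g)) ∧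
    (∀ j : Fin F.events.length, Passes (F.events.get j) (ρ j.castSucc) (ρ j.succ)) ∧
    ρ 0 = ρ (Fin.last _)

theorem finite_normalRulings (F : Front n) : {ρ | F.IsNormalRuling ρ}.Finite := by
  let ext : ((g : Fin (F.events.length + 1)) → Fin (F.width g) → Fin (F.width g)) →
      Fin (F.events.length + 1) → ℕ → ℕ :=
    fun f g i => if h : i < F.width g then (f g ⟨i, h⟩ : ℕ) else i
  refine (Set.finite_range ext).subset fun ρ hρ => ?_
  refine ⟨fun g i => ⟨ρ g i, ((hρ.1 g).1 i i.2).1⟩, ?_⟩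
  funext g i
  by_cases h : i < F.width g
  · simp [ext, h]
  · have := (hρ.1 g).2 i (not_lt.1 h)
    simp [ext, h, this]

/-- The number of switches: crossings that the ruling does not follow through. -/
noncomputable def switches (F : Front n) (ρ : Fin (F.events.length + 1) → ℕ → ℕ) : ℕ :=
  Nat.card {j : Fin F.events.length //
    (∃ k, F.events.get j = crossing k) ∧ ρ j.castSucc = ρ j.succ}

/-- The number of right cusps. -/
noncomputable def rightCusps (F : Front n) : ℕ :=
  Nat.card {j : Fin F.events.length // ∃ k, F.events.get j = rightCusp k}

/-- The ungraded ruling polynomial `∑_ρ z ^ (#switches - #right cusps)`. -/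
noncomputable def rulingPolynomial (F : Front n) : LaurentPolynomial ℤ :=
  ∑ ρ ∈ F.finite_normalRulings.toFinset,
    LaurentPolynomial.T ((F.switches ρ : ℤ) - (F.rightCusps : ℤ))

end Front

/-! ### Satellites -/

theorem IsTangle.append {a b c : ℕ} {l l' : List Event} (h : IsTangle a l b)
    (h' : IsTangle b l' c) : IsTangle a (l ++ l') c := by
  induction l generalizing a with
  | nil => cases h; exact h'
  | cons e l ih => exact ⟨h.1, ih h.2⟩

theorem IsTangle.split {a c : ℕ} {l : List Event} (h : IsTangle a l c) (g : ℕ) :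
    IsTangle a (l.take g) (strandsAfter a (l.take g)) ∧
      IsTangle (strandsAfter a (l.take g)) (l.drop g) c := by
  induction l generalizing a g with
  | nil => simpa [strandsAfter, IsTangle] using h
  | cons e l ih =>
    cases g with
    | zero => exact ⟨rfl, h⟩
    | succ g => exact ⟨⟨h.1, (ih h.2 g).1⟩, (ih h.2 g).2⟩

theorem IsTangle.shift {a b : ℕ} {l : List Event} (h : IsTangle a l b) (d c : ℕ) :
    IsTangle (d + a + c) (l.map (Event.shift d)) (d + b + c) := by
  induction l generalizing a with
  | nil => cases h; rfl
  | cons e l ih =>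
    obtain ⟨h1, h2⟩ := h
    have h3 := ih h2
    cases e <;> simp only [Fits, out] at h1 h3
    · refine ⟨by simp only [Event.shift, Fits]; omega, ?_⟩
      simp only [Event.shift, out]
      rwa [show d + a + c + 2 = d + (a + 2) + c by omega]
    · refine ⟨by simp only [Event.shift, Fits]; omega, ?_⟩
      simp only [Event.shift, out]
      rwa [show d + a + c - 2 = d + (a - 2) + c by omega]
    · exact ⟨by simp only [Event.shift, Fits]; omega, h3⟩

theorem IsTangle.reflect {a b : ℕ} {l : List Event} (h : IsTangle a l b) :
    IsTangle b (l.map Event.reflect).reverse a := by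
  induction l generalizing a with
  | nil => cases h; rfl
  | cons e l ih =>
    obtain ⟨h1, h2⟩ := h
    rw [List.map_cons, List.reverse_cons]
    refine (ih h2).append ?_
    cases e <;> simp only [Fits] at h1 <;>
      refine ⟨by simp only [Event.reflect, Fits, out]; omega, ?_⟩ <;>
      simp only [Event.reflect, out, IsTangle] <;> omega

theorem isTangle_crossings (n : ℕ) (l : List Event)
    (h : ∀ e ∈ l, ∃ k, e = crossing k ∧ k + 2 ≤ n) : IsTangle n l n := by
  induction l with
  | nil => rfl
  | cons e l ih =>
    obtain ⟨k, rfl, hk⟩ := h e (by simp)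
    exact ⟨hk, ih fun e' he' => h e' (by simp [he'])⟩

theorem isTangle_copyLeftCusp (N n k : ℕ) (h : k ≤ n) :
    IsTangle (N * n) (copyLeftCusp N k) (N * (n + 2)) := by
  have hkn : N * k ≤ N * n := Nat.mul_le_mul_left N h
  have h1 : ∀ M, IsTangle (N * n) ((List.range M).map fun j => leftCusp (N * k + 2 * j))
      (N * n + 2 * M) := by
    intro M
    induction M with
    | zero => rfl
    | succ M ih =>
      rw [List.range_succ, List.map_append]
      refine ih.append ⟨?_, ?_⟩
      · simp only [Fits]; omega
      · change N * n + 2 * M + 2 = N * n + 2 * (M + 1)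
        omega
  have h2 : N * (n + 2) = N * n + 2 * N := by ring
  rw [h2]
  refine (h1 N).append (isTangle_crossings _ _ ?_)
  intro e he
  simp only [List.mem_flatMap, List.mem_range, List.mem_map, List.mem_reverse] at he
  obtain ⟨j, hj, t, ht, rfl⟩ := he
  exact ⟨_, rfl, by omega⟩

theorem isTangle_copy (N n : ℕ) (e : Event) (h : e.Fits n) :
    IsTangle (N * n) (e.copy N) (N * e.out n) := by
  cases e with
  | leftCusp k => exact isTangle_copyLeftCusp N n k h
  | rightCusp k =>
    simp only [Fits] at h
    have := (isTangle_copyLeftCusp N (n - 2) k (by omega)).reflect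
    rwa [show n - 2 + 2 = n by omega] at this
  | crossing k =>
    simp only [Fits] at h
    have hkn : N * (k + 2) ≤ N * n := Nat.mul_le_mul_left N h
    rw [Nat.mul_add] at hkn
    refine isTangle_crossings _ _ ?_
    intro e he
    simp only [Event.copy, copyCrossing, List.mem_flatMap, List.mem_range, List.mem_map,
      List.mem_reverse] at he
    obtain ⟨j, hj, t, ht, rfl⟩ := he
    exact ⟨_, rfl, by omega⟩

theorem IsTangle.copy {a b : ℕ} {l : List Event} (h : IsTangle a l b) (N : ℕ) :
    IsTangle (N * a) (l.flatMap (Event.copy N)) (N * b) := by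
  induction l generalizing a with
  | nil => cases h; rfl
  | cons e l ih =>
    rw [List.flatMap_cons]
    exact (isTangle_copy N a e h.1).append (ih h.2)

/-- A base point on a front, away from its singularities. -/
structure BasePoint (F : Front 0) where
  gap : ℕ
  gap_le : gap ≤ F.events.length
  strand : ℕ
  strand_lt : strand < F.width gap

/-- The pattern as it is inserted at the base point: directly if the companion is oriented to the
right there, and reflected across a vertical axis otherwise. -/
def insertedEvents {N : ℕ} (L : Front N) (rightward : Bool) : List Event :=
  if rightward then L.events else (L.events.map Event.reflect).reverse

/-- The satellite `S(K, L)`: the `N`-copy of `K`, with the pattern `L` inserted into the `N` parallel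
strands at the base point; `rightward` tells whether `K` is oriented to the right there. -/
def satellite {N : ℕ} (K : Front 0) (b : BasePoint K) (rightward : Bool) (L : Front N) :
    Front 0 where
  events := (K.events.take b.gap).flatMap (Event.copy N) ++
    (insertedEvents L rightward).map (Event.shift (N * b.strand)) ++
    (K.events.drop b.gap).flatMap (Event.copy N)
  closed := by
    obtain ⟨h1, h2⟩ := K.closed.split b.gap
    have hL : IsTangle N (insertedEvents L rightward) N := by
      cases rightward
      · exact L.closed.reflect
      · exact L.closed
    have hs : strandsAfter 0 (K.events.take b.gap) =
        b.strand + 1 + (K.width b.gap - b.strand - 1) := by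
      have := b.strand_lt
      simp only [Front.width] at this ⊢
      omega
    have h3 := hL.shift (N * b.strand) (N * (K.width b.gap - b.strand - 1))
    rw [show N * b.strand + N + N * (K.width b.gap - b.strand - 1) =
      N * strandsAfter 0 (K.events.take b.gap) by rw [hs]; ring] at h3
    exact ((h1.copy N).append h3).append (h2.copy N)

/-- `K` is `L`-compatible: the ruling polynomials of `S(K, L)` and `L` differ. -/
def IsCompatible {N : ℕ} (K : Front 0) (b : BasePoint K) (rightward : Bool) (L : Front N) : Prop :=
  (satellite K b rightward L).rulingPolynomial ≠ L.rulingPolynomial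

/-! ### Legendrian knots in `ℝ³` -/

/-- A parametrized Legendrian knot in `ℝ³` with the contact structure `ker (dz - y dx)`. -/
structure LegendrianKnot where
  x : UnitAddCircle → ℝ
  y : UnitAddCircle → ℝ
  z : UnitAddCircle → ℝ
  smooth_x : ContDiff ℝ (⊤ : ℕ∞) fun t : ℝ => x t
  smooth_y : ContDiff ℝ (⊤ : ℕ∞) fun t : ℝ => y t
  smooth_z : ContDiff ℝ (⊤ : ℕ∞) fun t : ℝ => z t
  immersed : ∀ t : ℝ, deriv (fun t : ℝ => x t) t ≠ 0 ∨ deriv (fun t : ℝ => y t) t ≠ 0 ∨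
    deriv (fun t : ℝ => z t) t ≠ 0
  injective : Function.Injective fun t => (x t, y t, z t)
  legendrian : ∀ t : ℝ, deriv (fun t : ℝ => z t) t = y t * deriv (fun t : ℝ => x t) t

/-- The strands `i` and `i + 1` to the right of the event meet at it. -/
def Event.MeetsRight (e : Event) (i : ℕ) : Prop := e = leftCusp i ∨ e = crossing i

/-- The strands `i` and `i + 1` to the left of the event meet at it. -/
def Event.MeetsLeft (e : Event) (i : ℕ) : Prop := e = rightCusp i ∨ e = crossing i

/-- How the strands on the two sides of an event fit together: `p i` and `q i` are the parameters
at which the `i`-th strand to the left, respectively to the right, arrives at the event;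
`n` is the number of strands to the left. -/
def Event.Joins {X : Type*} : Event → ℕ → (ℕ → X) → (ℕ → X) → Prop
  | leftCusp k, n, p, q => q k = q (k + 1) ∧ ∀ i < n, p i = q (skip k i)
  | rightCusp k, n, p, q => p k = p (k + 1) ∧ ∀ i, i + 2 < n → p (skip k i) = q i
  | crossing k, n, p, q => p k ≠ p (k + 1) ∧ ∀ i < n, p i = q (Equiv.swap k (k + 1) i)

/-- The front projection of the Legendrian knot is generic, with all cusps and crossings at
distinct `x`-coordinates, and `F` is the resulting front diagram.  Here `c j` is the `x`-coordinate
of the `j`-th event, and over the gap `g + 1`, between `c g` and `c (g + 1)`, the `i`-th strand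
consists of the points with parameters `s (g + 1) i ξ`, for `c g ≤ ξ ≤ c (g + 1)`.
(There are no strands over the two unbounded gaps.) -/
def LegendrianKnot.HasFront (K : LegendrianKnot) (F : Front 0) : Prop :=
  -- the singularities of the front are semicubical cusps
  (∀ t : ℝ, deriv (fun t : ℝ => K.x t) t = 0 → deriv (deriv fun t : ℝ => K.x t) t ≠ 0) ∧
  ∃ (c : ℕ → ℝ) (s : ℕ → ℕ → ℝ → UnitAddCircle),
    (∀ g, g + 1 < F.events.length → c g < c (g + 1)) ∧
    -- the strands are sections
    (∀ g i, g + 1 < F.events.length → i < F.width (g + 1) →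
      ContinuousOn (s (g + 1) i) (Set.Icc (c g) (c (g + 1))) ∧
      ∀ ξ ∈ Set.Icc (c g) (c (g + 1)), K.x (s (g + 1) i ξ) = ξ) ∧
    -- they cover the knot
    (∀ t, ∃ g i, g + 1 < F.events.length ∧ i < F.width (g + 1) ∧
      ∃ ξ ∈ Set.Icc (c g) (c (g + 1)), s (g + 1) i ξ = t) ∧
    -- they are numbered from top to bottom, and meet only as prescribed by the events
    (∀ (g i i' : ℕ) (hg : g + 1 < F.events.length), i < i' → i' < F.width (g + 1) →
      ∀ ξ ∈ Set.Icc (c g) (c (g + 1)),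
        K.z (s (g + 1) i' ξ) < K.z (s (g + 1) i ξ) ∨
        (ξ = c g ∧ i' = i + 1 ∧ (F.events[g]).MeetsRight i) ∨
        (ξ = c (g + 1) ∧ i' = i + 1 ∧ (F.events[g + 1]).MeetsLeft i)) ∧
    -- at each event the strands are joined as prescribed
    (∀ (j : ℕ) (hj : j < F.events.length),
      (F.events[j]).Joins (F.width j) (fun i => s j i (c j)) (fun i => s (j + 1) i (c j)))

end LegendrianFront

/-!
The front `A₂` has no normal ruling, so it suffices to find a normal ruling of the satellite.  A normal
ruling of `K` decomposes the front into disks which begin at a left cusp, end at a right cusp and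
meet at switches.  In the 2-copy each disk is doubled, and companions are matched in the same or in
the opposite order, according to a state in `ZMod 2`.  The states can be chosen because the graph
of disks and switches is connected and is not a tree.
-/

namespace LegendrianFront

open Event

/-! The front `A₂` has no normal ruling: its only two strands would have to be paired, yet they
cross. So its ruling polynomial is 0. The coefficients of a ruling polynomial are counts, so one
normal ruling of the satellite suffices.

Fix a normal ruling of `K` with at least as many switches as right cusps. Its pairs of companions
sweep out disks, each running from a left to a right cusp. Take the multigraph with disks as
vertices and switches as edges. It is connected because `K` is a single circle
(`Ruled.eqvGen_switchAdj`), and it has at least as many edges as vertices, so it contains a cycle.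

In the 2-copy a pair of companions becomes four strands, paired with interleaved intervals (state 0)
or nested ones (state 1). Cusps are passed in state 0, and followed crossings carry the states
along. A switch can be resolved so that both of its disks change state or neither does; also one
alone may change if the other is in state 1 (`rulingPath_crossing_switch`). The inserted crossing
changes the state of its disk `D`, except that in state 1 it may be a switch and change nothing
(`rulingPath_base`). It remains to find a history of states that starts and ends at 0.

Ordinary switches change an even number of states and the inserted crossing changes one, so an
exceptional event is needed: some disk `C` in state 1 skips a change. Let `x` be a mod 2 chain of
switches with boundary `D + C`. The number of changes it prescribes at `C`, including the inserted
crossing if `C = D`, is odd. If it exceeds 1, suppress the second of these changes: `C` is then in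
state 1, and every disk ends in state 0 (`exists_states`). Such an `x` exists
(`exists_itemsAt_card`): take a chain of least support from `D` to the cycle, and add the cycle if
there is only one change at `C`. -/

theorem exists_card_filter_lt_eq_one (I : Finset ℕ) (h : 1 < I.card) :
    ∃ e ∈ I, (I.filter (· < e)).card = 1 := by
  have h0 : I.Nonempty := Finset.card_pos.1 (by omega)
  have h1 : (I.erase (I.min' h0)).Nonempty := by
    apply Finset.card_pos.1
    rw [Finset.card_erase_of_mem (I.min'_mem h0)]
    omega
  have he := Finset.mem_erase.1 ((I.erase (I.min' h0)).min'_mem h1)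
  refine ⟨_, he.2, Finset.card_eq_one.2 ⟨I.min' h0, ?_⟩⟩
  ext x
  simp only [Finset.mem_filter, Finset.mem_singleton]
  constructor
  · rintro ⟨hx, hlt⟩
    by_contra hne
    exact absurd (Finset.min'_le _ x (Finset.mem_erase.2 ⟨hne, hx⟩)) (not_le.2 hlt)
  · rintro rfl
    exact ⟨I.min'_mem h0, lt_of_le_of_ne (I.min'_le _ he.2) (Ne.symm he.1)⟩

theorem zmod_two_cases (x : ZMod 2) : x = 0 ∨ x = 1 := by
  revert x; decide

/-! ### Mod 2 chains in a multigraph and the history of states -/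

section Multigraph

variable (E : Finset ℕ) (a b : ℕ → ℕ)

/-- The incidence function modulo 2 of an edge with ends `a t` and `b t`. -/
def incidence (t v : ℕ) : ZMod 2 := (if v = a t then 1 else 0) + if v = b t then 1 else 0

/-- The boundary modulo 2 of a set of edges. -/
def boundary (x : ℕ → ZMod 2) (v : ℕ) : ZMod 2 := ∑ t ∈ E, x t * incidence a b t v

variable {E a b}

theorem boundary_add (x y : ℕ → ZMod 2) (v : ℕ) :
    boundary E a b (x + y) v = boundary E a b x v + boundary E a b y v := by
  simp [boundary, add_mul, Finset.sum_add_distrib]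

theorem boundary_single {t : ℕ} (ht : t ∈ E) (v : ℕ) :
    boundary E a b (Pi.single t 1) v = incidence a b t v := by
  rw [boundary, Finset.sum_eq_single t]
  · simp
  · intro s _ hs
    simp [Pi.single_eq_of_ne hs]
  · exact fun h => absurd ht h

theorem incidence_eq_zero {t v : ℕ} (h1 : v ≠ a t) (h2 : v ≠ b t) : incidence a b t v = 0 := by
  simp [incidence, h1, h2]

theorem incidence_left {t : ℕ} (h : a t ≠ b t) : incidence a b t (a t) = 1 := by
  simp [incidence, h]

theorem incidence_right {t : ℕ} (h : a t ≠ b t) : incidence a b t (b t) = 1 := by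
  simp [incidence, h.symm]

/-- An edge has two ends, so the coordinates of a boundary sum to zero mod 2 and the boundary map is
not onto. With at least as many edges as vertices it cannot be injective either. -/
theorem exists_cycle (V : Finset ℕ) (ha : ∀ t ∈ E, a t ∈ V) (hb : ∀ t ∈ E, b t ∈ V)
    (hV : V.Nonempty) (hcard : V.card ≤ E.card) :
    ∃ S : ℕ → ZMod 2, (∃ e ∈ E, S e ≠ 0) ∧ ∀ v, boundary E a b S v = 0 := by
  let f : (E → ZMod 2) →ₗ[ZMod 2] (V → ZMod 2) :=
    { toFun := fun x v => ∑ t : E, x t * incidence a b t v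
      map_add' := fun x y => by
        funext v; simp [add_mul, Finset.sum_add_distrib]
      map_smul' := fun c x => by
        funext v; simp [Finset.mul_sum, mul_assoc] }
  have hsum : ∀ x, ∑ v, f x v = 0 := by
    intro x
    change ∑ v : V, ∑ t : E, x t * incidence a b t v = 0
    rw [Finset.sum_comm]
    refine Finset.sum_eq_zero fun t _ => ?_
    rw [← Finset.mul_sum, Finset.sum_coe_sort V (fun v => incidence a b t v)]
    simp only [incidence, Finset.sum_add_distrib, Finset.sum_ite_eq', ha t t.2, hb t t.2, if_true]
    rw [CharTwo.add_self_eq_zero, mul_zero]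
  have hinj : ¬ Function.Injective f := by
    intro hf
    have h1 := LinearMap.finrank_le_finrank_of_injective hf
    simp only [Module.finrank_fintype_fun_eq_card, Fintype.card_coe] at h1
    have hs := (LinearMap.injective_iff_surjective_of_finrank_eq_finrank (f := f)
      (by simp only [Module.finrank_fintype_fun_eq_card, Fintype.card_coe]; omega)).1 hf
    obtain ⟨v, hv⟩ := hV
    obtain ⟨x, hx⟩ := hs (Pi.single ⟨v, hv⟩ 1)
    have := hsum x
    rw [hx] at this
    simp at this
  rw [injective_iff_map_eq_zero] at hinj
  push Not at hinj
  obtain ⟨x, hx0, hx⟩ := hinj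
  obtain ⟨e, he⟩ := Function.ne_iff.1 hx
  refine ⟨fun t => if h : t ∈ E then x ⟨t, h⟩ else 0, ⟨e, e.2, by simpa using he⟩, fun v => ?_⟩
  by_cases hv : v ∈ V
  · have := congrFun hx0 ⟨v, hv⟩
    rw [boundary, ← Finset.sum_coe_sort]
    simpa [f] using this
  · refine Finset.sum_eq_zero fun t ht => ?_
    rw [incidence_eq_zero, mul_zero]
    · rintro rfl; exact hv (ha t ht)
    · rintro rfl; exact hv (hb t ht)

/-- Take the mod 2 sum of the edges of a walk from `u` to `v`; intermediate vertices cancel. -/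
theorem exists_boundary_of_eqvGen {u v : ℕ}
    (h : Relation.EqvGen (fun x y => ∃ t ∈ E, a t = x ∧ b t = y) u v) :
    ∃ T : ℕ → ZMod 2, ∀ w, boundary E a b T w =
      (if w = u then 1 else 0) + if w = v then 1 else 0 := by
  induction h with
  | rel x y h =>
    obtain ⟨t, ht, rfl, rfl⟩ := h
    exact ⟨Pi.single t 1, fun w => boundary_single ht w⟩
  | refl x => exact ⟨0, fun w => by simp [boundary, CharTwo.add_self_eq_zero]⟩
  | symm x y _ ih =>
    obtain ⟨T, hT⟩ := ih
    exact ⟨T, fun w => by rw [hT, add_comm]⟩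
  | trans x y z _ _ ih1 ih2 =>
    obtain ⟨T, hT⟩ := ih1
    obtain ⟨T', hT'⟩ := ih2
    refine ⟨T + T', fun w => ?_⟩
    rw [boundary_add, hT, hT']
    have : (if w = y then (1 : ZMod 2) else 0) + (if w = y then 1 else 0) = 0 :=
      CharTwo.add_self_eq_zero _
    linear_combination this

/-- The edges in `x` at the vertex `C`, together with the half-edge `t₀` at `D`. -/
def itemsAt (E : Finset ℕ) (a b : ℕ → ℕ) (D t₀ : ℕ) (x : ℕ → ZMod 2) (C : ℕ) : Finset ℕ :=
  E.filter (fun t => x t * incidence a b t C = 1) ∪ if C = D then {t₀} else ∅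

/-- If `C = D` the boundary vanishes at `C` and the half-edge contributes 1; otherwise the boundary
is 1 there. So the number of items is odd. -/
theorem card_itemsAt {D t₀ : ℕ} (ht₀ : t₀ ∉ E) {x : ℕ → ZMod 2} {C : ℕ}
    (hx : ∀ w, boundary E a b x w = (if w = D then 1 else 0) + if w = C then 1 else 0) :
    ((itemsAt E a b D t₀ x C).card : ZMod 2) = 1 := by
  have h1 : ((E.filter (fun t => x t * incidence a b t C = 1)).card : ZMod 2) =
      boundary E a b x C := by
    rw [Finset.card_filter, boundary]
    push_cast
    refine Finset.sum_congr rfl fun t _ => ?_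
    rcases zmod_two_cases (x t * incidence a b t C) with h | h <;> simp [h]
  rw [itemsAt, Finset.card_union_of_disjoint]
  · push_cast
    rw [h1, hx]
    by_cases h : C = D
    · subst h; simp; decide
    · simp [h]
  · split_ifs
    · simp only [Finset.disjoint_singleton_right, Finset.mem_filter]
      exact fun h => ht₀ h.1
    · simp

/-- Let `T` have least support among chains from `D` to an end of an edge of a cycle `S`. If `T` has
a single item at its end `C`, minimality keeps that item off `S`, so `T + S` retains it and gains an
edge of `S` at `C`. -/
theorem exists_itemsAt_card (V : Finset ℕ) (ha : ∀ t ∈ E, a t ∈ V)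
    (hb : ∀ t ∈ E, b t ∈ V) (hab : ∀ t ∈ E, a t ≠ b t) (hcard : V.card ≤ E.card)
    {D t₀ : ℕ} (hD : D ∈ V) (ht₀ : t₀ ∉ E)
    (hconn : ∀ v ∈ V, Relation.EqvGen (fun x y => ∃ t ∈ E, a t = x ∧ b t = y) D v) :
    ∃ (x : ℕ → ZMod 2) (C : ℕ),
      (∀ w, boundary E a b x w = (if w = D then 1 else 0) + if w = C then 1 else 0) ∧
      1 < (itemsAt E a b D t₀ x C).card := by
  classical
  obtain ⟨S, ⟨e, he, hSe⟩, hS⟩ := exists_cycle V ha hb ⟨D, hD⟩ hcard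
  -- The minimum is taken over all ends `C` of edges of `S` at once, so that the endpoint may be
  -- moved along the cycle.
  let P : ℕ → Prop := fun m => ∃ (C : ℕ) (T : ℕ → ZMod 2) (e : ℕ), e ∈ E ∧ S e ≠ 0 ∧
    incidence a b e C = 1 ∧
    (∀ w, boundary E a b T w = (if w = D then 1 else 0) + if w = C then 1 else 0) ∧
    (E.filter (fun t => T t ≠ 0)).card = m
  have hP : ∃ m, P m := by
    obtain ⟨T, hT⟩ := exists_boundary_of_eqvGen (hconn _ (ha e he))
    exact ⟨_, a e, T, e, he, hSe, incidence_left (hab e he), hT, rfl⟩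
  obtain ⟨C, T, e, he, hSe, heC, hT, hcardT⟩ := Nat.find_spec hP
  have hmin : ∀ m, P m → Nat.find hP ≤ m := fun m hm => Nat.find_min' hP hm
  by_cases h1 : 1 < (itemsAt E a b D t₀ T C).card
  · exact ⟨T, C, hT, h1⟩
  refine ⟨T + S, C, fun w => by rw [boundary_add, hS, add_zero, hT], ?_⟩
  have hT1 : (itemsAt E a b D t₀ T C).card = 1 := by
    have := card_itemsAt ht₀ hT
    rcases Nat.eq_zero_or_pos (itemsAt E a b D t₀ T C).card with h | h
    · rw [h] at this; exact absurd this (by decide)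
    · omega
  obtain ⟨x, hx⟩ := Finset.card_eq_one.1 hT1
  have hSe1 : S e = 1 := (zmod_two_cases _).resolve_left hSe
  have hmem : x ∈ itemsAt E a b D t₀ T C := by simp [hx]
  have honly : ∀ t ∈ itemsAt E a b D t₀ T C, t = x := fun t ht => by simpa [hx] using ht
  have hxe : x ≠ e ∧ x ∈ itemsAt E a b D t₀ (T + S) C := by
    rcases Finset.mem_union.1 hmem with h | h
    · obtain ⟨hxE, hxC⟩ := Finset.mem_filter.1 h
      have hTx : T x = 1 := (zmod_two_cases _).resolve_left fun h0 => by simp [h0] at hxC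
      have hix : incidence a b x C = 1 := by simpa [hTx] using hxC
      have hSx : S x = 0 := by
        -- If `x` lay on `S`, deleting it from `T` would move the endpoint to its other end `C'`,
        -- still on the cycle, with smaller support.
        by_contra hSx
        obtain ⟨C', hC'1, hC'⟩ : ∃ C', incidence a b x C' = 1 ∧
            ∀ w, incidence a b x w = (if w = C then 1 else 0) + if w = C' then 1 else 0 := by
          by_cases h1 : C = a x
          · exact ⟨b x, incidence_right (hab x hxE), fun w => by simp [incidence, h1]⟩
          · by_cases h2 : C = b x
            · exact ⟨a x, incidence_left (hab x hxE), fun w => by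
                simp [incidence, h2, add_comm]⟩
            · rw [incidence_eq_zero h1 h2] at hix
              exact absurd hix (by decide)
        have := hmin _ ⟨C', T + Pi.single x 1, x, hxE, hSx, hC'1, fun w => by
          rw [boundary_add, hT, boundary_single hxE, hC']
          have : (if w = C then (1 : ZMod 2) else 0) + (if w = C then 1 else 0) = 0 :=
            CharTwo.add_self_eq_zero _
          linear_combination this, rfl⟩
        rw [← hcardT] at this
        refine absurd this (not_le.2 (Finset.card_lt_card ?_))
        refine Finset.ssubset_iff_of_subset ?_ |>.2 ⟨x, by simp [hxE, hTx], ?_⟩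
        · intro t ht
          simp only [Finset.mem_filter, Pi.add_apply] at ht ⊢
          refine ⟨ht.1, fun h0 => ht.2 ?_⟩
          have : t ≠ x := by rintro rfl; simp [h0] at hTx
          rw [h0, Pi.single_eq_of_ne this, add_zero]
        · simp [hTx, CharTwo.add_self_eq_zero]
      refine ⟨by rintro rfl; exact hSe hSx, Finset.mem_union_left _ (Finset.mem_filter.2 ⟨hxE, ?_⟩)⟩
      simp [hSx, hTx, hix]
    · refine ⟨?_, Finset.mem_union_right _ h⟩
      rintro rfl
      split_ifs at h
      · rw [Finset.mem_singleton] at h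
        subst h
        exact ht₀ he
      · simp at h
  have hTe : T e = 0 := by
    refine (zmod_two_cases _).resolve_right fun h => hxe.1 ?_
    exact (honly e (Finset.mem_union_left _ (Finset.mem_filter.2 ⟨he, by simp [h, heC]⟩))).symm
  refine Finset.one_lt_card.2 ⟨x, hxe.2, e, ?_, hxe.1⟩
  exact Finset.mem_union_left _ (Finset.mem_filter.2 ⟨he, by simp [hTe, hSe1, heC]⟩)

/-- States modulo 2 of the vertices of a connected multigraph with at least as many edges as
vertices, whose edges and a half-edge `t₀` at `D` are passed in linear order.  All states vanish at
the beginning and at the end; passing an edge changes the states of both or of none of its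
ends, except that an end of state `1` may be left unchanged; passing the half-edge changes the state
of `D`, unless this is `1`, when it may be left unchanged. -/
theorem exists_states (V : Finset ℕ) (ha : ∀ t ∈ E, a t ∈ V)
    (hb : ∀ t ∈ E, b t ∈ V) (hab : ∀ t ∈ E, a t ≠ b t) (hcard : V.card ≤ E.card)
    {D t₀ : ℕ} (hD : D ∈ V) (ht₀ : t₀ ∉ E)
    (hconn : ∀ v ∈ V, Relation.EqvGen (fun x y => ∃ t ∈ E, a t = x ∧ b t = y) D v) :
    ∃ N : ℕ → ℕ → ZMod 2, (∀ v, N 0 v = 0) ∧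
      (∀ T v, (∀ t ∈ insert t₀ E, t < T) → N T v = 0) ∧
      (∀ t v, t ∉ insert t₀ E → N (t + 1) v = N t v) ∧
      (∀ t ∈ E, ∀ v, v ≠ a t → v ≠ b t → N (t + 1) v = N t v) ∧
      (∀ t ∈ E, N (t + 1) (a t) + N t (a t) = N (t + 1) (b t) + N t (b t) ∨
        (N t (a t) = 1 ∧ N (t + 1) (a t) = 1) ∨ (N t (b t) = 1 ∧ N (t + 1) (b t) = 1)) ∧
      (∀ v ≠ D, N (t₀ + 1) v = N t₀ v) ∧
      (N (t₀ + 1) D = N t₀ D + 1 ∨ (N t₀ D = 1 ∧ N (t₀ + 1) D = 1)) := by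
  classical
  obtain ⟨x, C, hx, hI⟩ := exists_itemsAt_card V ha hb hab hcard hD ht₀ hconn
  -- `e` is the second item at `C`: exactly one change of `C` precedes it, so `C` has state 1 when
  -- `e` is passed.
  obtain ⟨e, heI, he1⟩ := exists_card_filter_lt_eq_one _ hI
  -- `full` records the changes of state prescribed by `x` and the half-edge; `τ` omits the change
  -- of `C` at `e`. The states are the partial sums of `τ`.
  let full : ℕ → ℕ → ZMod 2 := fun t v =>
    (if t ∈ E then x t * incidence a b t v else 0) + if t = t₀ then (if v = D then 1 else 0) else 0
  let τ : ℕ → ℕ → ZMod 2 := fun t v => full t v + if t = e then (if v = C then 1 else 0) else 0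
  have hfull : ∀ t, full t C = if t ∈ itemsAt E a b D t₀ x C then 1 else 0 := by
    intro t
    simp only [full, itemsAt, Finset.mem_union, Finset.mem_filter]
    generalize x t * incidence a b t C = y
    by_cases h : t ∈ E
    · have : t ≠ t₀ := by rintro rfl; exact ht₀ h
      rcases zmod_two_cases y with rfl | rfl <;> by_cases hCD : C = D <;> simp [h, this, hCD]
    · by_cases hCD : C = D <;> simp [h, hCD]
  have hNe : ∑ s ∈ Finset.range e, τ s C = 1 := by
    have h1 : ∑ s ∈ Finset.range e, τ s C =
        ∑ s ∈ Finset.range e, if s ∈ itemsAt E a b D t₀ x C then (1 : ZMod 2) else 0 := by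
      refine Finset.sum_congr rfl fun s hs => ?_
      have : s ≠ e := (Finset.mem_range.1 hs).ne
      simp only [τ, hfull, this, if_false, add_zero]
    rw [h1, Finset.sum_boole]
    have h2 : (Finset.range e).filter (· ∈ itemsAt E a b D t₀ x C) =
        (itemsAt E a b D t₀ x C).filter (· < e) := by
      ext s; simp [and_comm]
    rw [h2, he1, Nat.cast_one]
  have hfe : full e C = 1 := by simp [hfull, heI]
  have hτe : τ e C = 0 := by
    simp only [τ, hfe, if_true]; decide
  have hsucc : ∀ t v, ∑ s ∈ Finset.range (t + 1), τ s v = ∑ s ∈ Finset.range t, τ s v + τ t v :=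
    fun t v => Finset.sum_range_succ _ _
  have heq : ∀ u : ZMod 2, u + u = 0 := CharTwo.add_self_eq_zero
  have heC : e ∈ E → C = a e ∨ C = b e := by
    intro h
    by_contra hne
    push Not at hne
    have : e ≠ t₀ := by rintro rfl; exact ht₀ h
    simp [full, this, incidence_eq_zero hne.1 hne.2] at hfe
  refine ⟨fun t v => ∑ s ∈ Finset.range t, τ s v, fun v => by simp, ?_, ?_, ?_, ?_, ?_, ?_⟩
  · intro T v hT
    have hsub : insert t₀ E ⊆ Finset.range T := fun t ht => Finset.mem_range.2 (hT t ht)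
    have heT : e ∈ Finset.range T := by
      refine hsub ?_
      rcases Finset.mem_union.1 heI with h | h
      · exact Finset.mem_insert_of_mem (Finset.mem_filter.1 h).1
      · split_ifs at h
        · rw [Finset.mem_singleton] at h
          simp [h]
        · simp at h
    -- The total change is the boundary `D + C`, plus `D` from the half-edge, plus `C` from the
    -- omission, which is zero mod 2.
    simp only [τ, full, Finset.sum_add_distrib]
    rw [Finset.sum_ite_eq', Finset.sum_ite_eq', if_pos heT, if_pos (hsub (by simp)),
      ← Finset.sum_filter, Finset.filter_mem_eq_inter,
      Finset.inter_eq_right.2 fun t ht => hsub (Finset.mem_insert_of_mem ht)]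
    have := hx v
    rw [boundary] at this
    rw [this]
    linear_combination heq (if v = D then 1 else 0) + heq (if v = C then 1 else 0)
  · intro t v ht
    have hte : t ≠ e := by
      rintro rfl
      rw [Finset.mem_insert, not_or] at ht
      simp [full, ht] at hfe
    rw [Finset.mem_insert, not_or] at ht
    change ∑ s ∈ Finset.range (t + 1), τ s v = _
    rw [hsucc]
    simp [τ, full, ht, hte]
  · intro t ht v h1 h2
    change ∑ s ∈ Finset.range (t + 1), τ s v = _
    rw [hsucc]
    have h3 : t ≠ t₀ := by rintro rfl; exact ht₀ ht
    have h4 : t = e → v ≠ C := by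
      rintro rfl rfl
      exact (heC ht).elim h1 h2
    have h5 : (if t = e then (if v = C then (1 : ZMod 2) else 0) else 0) = 0 := by
      by_cases h : t = e
      · simp [h4 h]
      · simp [h]
    simp [τ, full, h3, h5, incidence_eq_zero h1 h2]
  · intro t ht
    beta_reduce
    rw [hsucc, hsucc]
    by_cases hte : t = e
    · subst hte
      rcases heC ht with h | h
      · right; left
        rw [← h, hNe, hτe]; simp
      · right; right
        rw [← h, hNe, hτe]; simp
    · left
      have h3 : t ≠ t₀ := by rintro rfl; exact ht₀ ht
      have h4 : τ t (a t) = τ t (b t) := by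
        simp [τ, full, hte, h3, incidence_left (hab t ht), incidence_right (hab t ht)]
      rw [h4]
      linear_combination heq (∑ s ∈ Finset.range t, τ s (a t)) -
        heq (∑ s ∈ Finset.range t, τ s (b t))
  · intro v hv
    beta_reduce
    rw [hsucc]
    have h4 : t₀ = e → v ≠ C := by
      rintro rfl rfl
      simp [full, ht₀, hv] at hfe
    have h5 : (if t₀ = e then (if v = C then (1 : ZMod 2) else 0) else 0) = 0 := by
      by_cases h : t₀ = e
      · simp [h4 h]
      · simp [h]
    simp [τ, full, ht₀, hv, h5]
  · beta_reduce
    rw [hsucc]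
    by_cases h : t₀ = e
    · have hCD : C = D := by
        by_contra hne
        rw [← h] at hfe
        simp [full, ht₀, hne] at hfe
      right
      rw [h, ← hCD, hNe, hτe]; simp
    · left
      simp [τ, full, ht₀, h]

end Multigraph

/-! ### Rulings as composable paths of pairings -/

/-- The ruling `p` at the left end of a sequence of events extends over it, with `q` at the right
end; there are `n` strands at the left end. -/
def RulingPath : ℕ → List Event → (ℕ → ℕ) → (ℕ → ℕ) → Prop
  | n, [], p, q => IsPairing n p ∧ p = q
  | n, e :: l, p, q => IsPairing n p ∧ ∃ r, Passes e p r ∧ RulingPath (e.out n) l r q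

namespace RulingPath

theorem isPairing_left {n : ℕ} {l : List Event} {p q : ℕ → ℕ} (h : RulingPath n l p q) :
    IsPairing n p := by
  cases l <;> exact h.1

theorem append {n m : ℕ} {l l' : List Event} {p q r : ℕ → ℕ} (h : RulingPath n l p q)
    (hm : strandsAfter n l = m) (h' : RulingPath m l' q r) : RulingPath n (l ++ l') p r := by
  induction l generalizing n p with
  | nil =>
    obtain ⟨h1, rfl⟩ := h
    cases hm
    exact h'
  | cons e l ih =>
    obtain ⟨h1, s, hs, h2⟩ := h
    exact ⟨h1, s, hs, ih h2 hm⟩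

theorem exists_sequence {n : ℕ} {l : List Event} {p q : ℕ → ℕ} (h : RulingPath n l p q) :
    ∃ ρ : ℕ → ℕ → ℕ, ρ 0 = p ∧ ρ l.length = q ∧
      (∀ g ≤ l.length, IsPairing (strandsAfter n (l.take g)) (ρ g)) ∧
      ∀ (j : ℕ) (hj : j < l.length), Passes l[j] (ρ j) (ρ (j + 1)) := by
  induction l generalizing n p with
  | nil =>
    obtain ⟨h1, rfl⟩ := h
    refine ⟨fun _ => p, rfl, rfl, fun g _ => ?_, fun j hj => absurd hj (by simp)⟩
    simpa [strandsAfter] using h1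
  | cons e l ih =>
    obtain ⟨h1, s, hs, h2⟩ := h
    obtain ⟨ρ, h0, hl, hp, hρ⟩ := ih h2
    refine ⟨fun g => Nat.casesOn g p ρ, rfl, hl, ?_, ?_⟩
    · rintro (_ | g) hg
      · exact h1
      · exact hp g (by simpa using hg)
    · rintro (_ | j) hj
      · simpa [h0] using hs
      · exact hρ j (by simpa using hj)

end RulingPath

theorem Front.exists_isNormalRuling {n : ℕ} (F : Front n) {p : ℕ → ℕ}
    (h : RulingPath n F.events p p) : ∃ ρ, F.IsNormalRuling ρ := by
  obtain ⟨ρ, h0, hl, hp, hρ⟩ := h.exists_sequence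
  refine ⟨fun g => ρ g, fun g => hp g (by omega), fun j => hρ j j.2, ?_⟩
  simp [h0, hl]

theorem swap_succ_apply (m i : ℕ) : Equiv.swap m (m + 1) i =
    if i = m then m + 1 else if i = m + 1 then m else i := Equiv.swap_apply_def _ _ _

/-- The pairing `p` after exchanging the strands `m` and `m + 1`. -/
def cross (m : ℕ) (p : ℕ → ℕ) : ℕ → ℕ :=
  fun i => Equiv.swap m (m + 1) (p (Equiv.swap m (m + 1) i))

theorem cross_eq_iff {m : ℕ} {p q : ℕ → ℕ} : cross m p = q ↔
    ∀ i, q (Equiv.swap m (m + 1) i) = Equiv.swap m (m + 1) (p i) := by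
  constructor
  · rintro rfl i
    simp [cross]
  · intro h
    funext i
    rw [cross, ← h]
    simp

theorem cross_cross (m : ℕ) (p : ℕ → ℕ) : cross m (cross m p) = p := by
  funext i; simp [cross]

theorem IsPairing.cross {n m : ℕ} {p : ℕ → ℕ} (h : IsPairing n p) (hm : m + 2 ≤ n) :
    IsPairing n (cross m p) := by
  have hs : ∀ i, i < n → Equiv.swap m (m + 1) i < n := by
    intro i hi
    rw [swap_succ_apply]
    split_ifs <;> omega
  have hs' : ∀ i, n ≤ i → Equiv.swap m (m + 1) i = i := by
    intro i hi
    rw [swap_succ_apply]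
    split_ifs <;> omega
  refine ⟨fun i hi => ?_, fun i hi => ?_⟩
  · obtain ⟨h1, h2, h3⟩ := h.1 _ (hs i hi)
    refine ⟨hs _ h1, fun h4 => h2 ?_, ?_⟩
    · rw [LegendrianFront.cross, ← Equiv.eq_symm_apply, Equiv.symm_swap] at h4
      exact h4
    · simp [LegendrianFront.cross, h3]
  · simp [LegendrianFront.cross, hs' i hi, h.2 i hi]

/-- Turns disjointness and nesting of intervals into order relations between companions, so that
`omega` can decide normality. The three cases are: both companions above, one on each outer side,
both below. -/
theorem IsPairing.isNormal_iff {n k : ℕ} {p : ℕ → ℕ} (h : IsPairing n p) (hk : k + 2 ≤ n)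
    (hpk : p k ≠ k + 1) : IsNormal k p ↔
      (p (k + 1) < p k ∧ p k < k) ∨ (p k < k ∧ k + 1 < p (k + 1)) ∨
        (k + 1 < p (k + 1) ∧ p (k + 1) < p k) := by
  have h1 := h.1 k (by omega)
  have h2 := h.1 (k + 1) (by omega)
  have h3 : p (k + 1) ≠ k := fun h3 => hpk (by rw [← h2.2.2, h3])
  have h4 : p k ≠ p (k + 1) := fun h4 => by
    have := h1.2.2
    rw [h4, h2.2.2] at this
    omega
  rw [IsNormal]
  clear h
  generalize p k = x at *
  generalize p (k + 1) = y at *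
  rcases lt_or_gt_of_ne h1.2.1 with hx | hx <;> rcases lt_or_gt_of_ne h2.2.1 with hy | hy
  · rw [Set.uIcc_of_ge hx.le, Set.uIcc_of_ge hy.le]
    simp only [Set.disjoint_iff_inter_eq_empty, Set.Icc_inter_Icc, Set.Icc_eq_empty_iff,
      Set.Icc_subset_Icc_iff hx.le, Set.Icc_subset_Icc_iff hy.le]
    omega
  · rw [Set.uIcc_of_ge hx.le, Set.uIcc_of_le hy.le]
    simp only [Set.disjoint_iff_inter_eq_empty, Set.Icc_inter_Icc, Set.Icc_eq_empty_iff,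
      Set.Icc_subset_Icc_iff hx.le, Set.Icc_subset_Icc_iff hy.le]
    omega
  · rw [Set.uIcc_of_le hx.le, Set.uIcc_of_ge hy.le]
    simp only [Set.disjoint_iff_inter_eq_empty, Set.Icc_inter_Icc, Set.Icc_eq_empty_iff,
      Set.Icc_subset_Icc_iff hx.le, Set.Icc_subset_Icc_iff hy.le]
    omega
  · rw [Set.uIcc_of_le hx.le, Set.uIcc_of_le hy.le]
    simp only [Set.disjoint_iff_inter_eq_empty, Set.Icc_inter_Icc, Set.Icc_eq_empty_iff,
      Set.Icc_subset_Icc_iff hx.le, Set.Icc_subset_Icc_iff hy.le]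
    omega

namespace RulingPath

theorem crossing_pass {n m : ℕ} {l : List Event} {p q : ℕ → ℕ} (hp : IsPairing n p)
    (hm : p m ≠ m + 1) (h : RulingPath n l (cross m p) q) :
    RulingPath n (crossing m :: l) p q :=
  ⟨hp, _, ⟨hm, Or.inl (cross_eq_iff.1 rfl)⟩, h⟩

theorem crossing_switch {n m : ℕ} {l : List Event} {p q : ℕ → ℕ}
    (hm : p m ≠ m + 1) (hn : IsNormal m p) (h : RulingPath n l p q) :
    RulingPath n (crossing m :: l) p q :=
  ⟨h.isPairing_left, _, ⟨hm, Or.inr ⟨rfl, hn⟩⟩, h⟩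

theorem refl {n : ℕ} {p : ℕ → ℕ} (hp : IsPairing n p) : RulingPath n [] p p := ⟨hp, rfl⟩

end RulingPath

/-! ### Local models for the 2-copy -/

/-- The pairing of the 2-copy induced by a pairing `p`: companions of the two copies of `i` are the
two copies of `p i`, in the same order if `n i = 0`, and in the opposite order if `n i = 1`. -/
def double (p : ℕ → ℕ) (n : ℕ → ZMod 2) (i : ℕ) : ℕ :=
  2 * p (i / 2) + (i + (n (i / 2)).val) % 2

theorem IsPairing.double {w : ℕ} {p : ℕ → ℕ} {n : ℕ → ZMod 2} (h : IsPairing w p)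
    (hn : ∀ i, n (p i) = n i) (hw : ∀ i, w ≤ i → n i = 0) : IsPairing (2 * w) (double p n) := by
  have hd : ∀ i, LegendrianFront.double p n i / 2 = p (i / 2) := fun i => by
    rw [LegendrianFront.double]; omega
  refine ⟨fun i hi => ?_, fun i hi => ?_⟩
  · obtain ⟨h1, h2, h3⟩ := h.1 (i / 2) (by omega)
    refine ⟨?_, ?_, ?_⟩
    · rw [LegendrianFront.double]; omega
    · intro h4
      exact h2 (by rw [← hd, h4])
    · rw [LegendrianFront.double, hd, h3, hn, LegendrianFront.double]
      omega
  · rw [LegendrianFront.double, h.2 _ (by omega), hw _ (by omega), ZMod.val_zero]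
    omega

theorem double_two_mul (p : ℕ → ℕ) (n : ℕ → ZMod 2) (k : ℕ) :
    double p n (2 * k) = 2 * p k + (n k).val := by
  have := ZMod.val_lt (n k)
  rw [double, Nat.mul_div_cancel_left _ two_pos]
  omega

theorem double_two_mul_add_one (p : ℕ → ℕ) (n : ℕ → ZMod 2) (k : ℕ) :
    double p n (2 * k + 1) = 2 * p k + 1 - (n k).val := by
  have := ZMod.val_lt (n k)
  rw [double, show (2 * k + 1) / 2 = k by omega]
  omega

/-- Change the state of the pair containing `k`. -/
def toggle (k : ℕ) (p : ℕ → ℕ) (n : ℕ → ZMod 2) (i : ℕ) : ZMod 2 :=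
  if i = k ∨ i = p k then n i + 1 else n i

theorem val_add_one (x : ZMod 2) : (x + 1).val = 1 - x.val := by
  revert x; decide

/-- Exchanging the two copies of `k` while the copies of `p k` stay in place reverses their relative
order. -/
theorem cross_double {w k : ℕ} {p : ℕ → ℕ} {n : ℕ → ZMod 2} (h : IsPairing w p) (hk : k < w) :
    cross (2 * k) (double p n) = double p (toggle k p n) := by
  obtain ⟨h1, h2, h3⟩ := h.1 k hk
  rw [cross_eq_iff]
  intro i
  have hpi : p (i / 2) = k ↔ i / 2 = p k := by
    constructor
    · rintro rfl
      by_cases hi : i / 2 < w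
      · exact (h.1 _ hi).2.2.symm
      · rw [h.2 _ (by omega)] at hk; omega
    · intro h4; rw [h4, h3]
  have hd : Equiv.swap (2 * k) (2 * k + 1) i / 2 = i / 2 := by
    rw [swap_succ_apply]; split_ifs <;> omega
  have := ZMod.val_lt (n (i / 2))
  rw [double, double, hd, toggle]
  by_cases ha : i / 2 = k
  · rw [if_pos (Or.inl ha), val_add_one, swap_succ_apply, swap_succ_apply]
    have : p (i / 2) ≠ k := by rw [ha]; exact h2
    split_ifs <;> omega
  · by_cases hb : i / 2 = p k
    · rw [if_pos (Or.inr hb), val_add_one, swap_succ_apply, swap_succ_apply]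
      have := hpi.2 hb
      split_ifs <;> omega
    · rw [if_neg (by tauto), swap_succ_apply, swap_succ_apply]
      have : p (i / 2) ≠ k := fun h => hb (hpi.1 h)
      split_ifs <;> omega

theorem copy_two_crossing (k : ℕ) : (crossing k).copy 2 =
    [crossing (2 * k + 1), crossing (2 * k), crossing (2 * k + 2), crossing (2 * k + 1)] := by
  simp [Event.copy, copyCrossing, List.range_succ]

theorem copy_two_leftCusp (k : ℕ) : (leftCusp k).copy 2 =
    [leftCusp (2 * k), leftCusp (2 * k + 2), crossing (2 * k + 1)] := by
  simp [Event.copy, copyLeftCusp, List.range_succ]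

/-- No two of the four strands `c, …, c + 3` are paired. -/
def IsExternal (c : ℕ) (p : ℕ → ℕ) : Prop := ∀ i, c ≤ i → i < c + 4 → p i < c ∨ c + 4 ≤ p i

/-- Companions lie outside the block of four strands, so a crossing inside the block does not move
them; only the argument is permuted. -/
theorem cross_apply_of_external {c m i : ℕ} {p : ℕ → ℕ} (h : IsExternal c p) (h1 : c ≤ m)
    (h2 : m < c + 3) (hi1 : c ≤ i) (hi2 : i < c + 4) :
    cross m p i = p (if i = m then m + 1 else if i = m + 1 then m else i) := by
  rw [cross, swap_succ_apply m i]
  have := h (if i = m then m + 1 else if i = m + 1 then m else i)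
    (by split_ifs <;> omega) (by split_ifs <;> omega)
  generalize p (if i = m then m + 1 else if i = m + 1 then m else i) = x at *
  rw [swap_succ_apply]
  split_ifs <;> omega

theorem IsExternal.cross {c m : ℕ} {p : ℕ → ℕ} (h : IsExternal c p) (h1 : c ≤ m)
    (h2 : m < c + 3) : IsExternal c (cross m p) := by
  intro i hi1 hi2
  rw [cross_apply_of_external h h1 h2 hi1 hi2]
  exact h _ (by split_ifs <;> omega) (by split_ifs <;> omega)

theorem IsExternal.ne {c m : ℕ} {p : ℕ → ℕ} (h : IsExternal c p) (h1 : c ≤ m)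
    (h2 : m < c + 3) : p m ≠ m + 1 := by
  have := h m h1 (by omega)
  omega

/-- With all companions outside the block, the exact place `m` within it is irrelevant, and
comparison with `c` suffices. -/
theorem IsExternal.isNormal {n c m : ℕ} {p : ℕ → ℕ} (h : IsExternal c p) (hp : IsPairing n p)
    (hc : c + 4 ≤ n) (h1 : c ≤ m) (h2 : m < c + 3)
    (hN : (p (m + 1) < p m ∧ p m < c) ∨ (p m < c ∧ c < p (m + 1)) ∨
        (c < p (m + 1) ∧ p (m + 1) < p m)) : IsNormal m p := by
  rw [hp.isNormal_iff (by omega) (h.ne h1 h2)]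
  have := h m h1 (by omega)
  have := h (m + 1) (by omega) (by omega)
  omega

theorem isExternal_double {w k : ℕ} {p : ℕ → ℕ} {n : ℕ → ZMod 2} (h : IsPairing w p)
    (hk : k + 2 ≤ w) (hpk : p k ≠ k + 1) : IsExternal (2 * k) (double p n) := by
  intro i h1 h2
  have e1 := h.1 k (by omega)
  have e2 := h.1 (k + 1) (by omega)
  have h3 : p (k + 1) ≠ k := fun h3 => hpk (by rw [← e2.2.2, h3])
  rw [double]
  have : i / 2 = k ∨ i / 2 = k + 1 := by omega
  rcases this with h | h <;> rw [h] <;> omega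

/-- As a permutation, the 2-copy of a crossing exchanges two blocks of two strands and keeps the
order inside each. -/
theorem swap_swap_swap_swap (k i : ℕ) :
    Equiv.swap (2 * k + 1) (2 * k + 1 + 1) (Equiv.swap (2 * k + 2) (2 * k + 2 + 1)
      (Equiv.swap (2 * k) (2 * k + 1) (Equiv.swap (2 * k + 1) (2 * k + 1 + 1) i))) =
      2 * Equiv.swap k (k + 1) (i / 2) + i % 2 := by
  have key : ∀ x y z w, Equiv.swap (2 * k + 1) (2 * k + 1 + 1) i = x →
      Equiv.swap (2 * k) (2 * k + 1) x = y → Equiv.swap (2 * k + 2) (2 * k + 2 + 1) y = z →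
      Equiv.swap (2 * k + 1) (2 * k + 1 + 1) z = w →
      w = 2 * Equiv.swap k (k + 1) (i / 2) + i % 2 →
      Equiv.swap (2 * k + 1) (2 * k + 1 + 1) (Equiv.swap (2 * k + 2) (2 * k + 2 + 1)
        (Equiv.swap (2 * k) (2 * k + 1) (Equiv.swap (2 * k + 1) (2 * k + 1 + 1) i))) =
        2 * Equiv.swap k (k + 1) (i / 2) + i % 2 := by
    rintro x y z w rfl rfl rfl rfl h
    exact h
  simp only [swap_succ_apply] at key ⊢
  by_cases h0 : i = 2 * k
  · refine key (2 * k) (2 * k + 1) (2 * k + 1) (2 * k + 2) ?_ ?_ ?_ ?_ ?_ <;> split_ifs <;> omega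
  by_cases h1 : i = 2 * k + 1
  · refine key (2 * k + 2) (2 * k + 2) (2 * k + 3) (2 * k + 3) ?_ ?_ ?_ ?_ ?_ <;> split_ifs <;> omega
  by_cases h2 : i = 2 * k + 2
  · refine key (2 * k + 1) (2 * k) (2 * k) (2 * k) ?_ ?_ ?_ ?_ ?_ <;> split_ifs <;> omega
  by_cases h3 : i = 2 * k + 3
  · refine key (2 * k + 3) (2 * k + 3) (2 * k + 2) (2 * k + 1) ?_ ?_ ?_ ?_ ?_ <;> split_ifs <;> omega
  · refine key i i i i ?_ ?_ ?_ ?_ ?_ <;> split_ifs <;> omega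

theorem swap_swap_swap_swap' (k i : ℕ) :
    Equiv.swap (2 * k + 1) (2 * k + 1 + 1) (Equiv.swap (2 * k) (2 * k + 1)
      (Equiv.swap (2 * k + 2) (2 * k + 2 + 1) (Equiv.swap (2 * k + 1) (2 * k + 1 + 1) i))) =
      2 * Equiv.swap k (k + 1) (i / 2) + i % 2 := by
  have h := swap_swap_swap_swap k (2 * Equiv.swap k (k + 1) (i / 2) + i % 2)
  rw [show (2 * Equiv.swap k (k + 1) (i / 2) + i % 2) / 2 = Equiv.swap k (k + 1) (i / 2) by omega,
    show (2 * Equiv.swap k (k + 1) (i / 2) + i % 2) % 2 = i % 2 by omega, Equiv.swap_apply_self,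
    Nat.div_add_mod] at h
  nth_rw 1 [← h]
  simp

/-- All four crossings are followed, so the states travel with the strands. -/
theorem rulingPath_crossing_followed {w k : ℕ} {p q : ℕ → ℕ} {n n' : ℕ → ZMod 2}
    (h : IsPairing w p) (hn : ∀ i, n (p i) = n i) (hw : ∀ i, w ≤ i → n i = 0)
    (hk : k + 2 ≤ w) (hpk : p k ≠ k + 1)
    (hq : ∀ i, q (Equiv.swap k (k + 1) i) = Equiv.swap k (k + 1) (p i))
    (hn' : ∀ i, n' (Equiv.swap k (k + 1) i) = n i) :
    RulingPath (2 * w) ((crossing k).copy 2) (double p n) (double q n') := by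
  have hP := h.double hn hw
  have hE := isExternal_double (n := n) h hk hpk
  have hE1 := hE.cross (m := 2 * k + 1) (by omega) (by omega)
  have hE2 := hE1.cross (m := 2 * k) (by omega) (by omega)
  have hE3 := hE2.cross (m := 2 * k + 2) (by omega) (by omega)
  have hP1 := hP.cross (m := 2 * k + 1) (by omega)
  have hP2 := hP1.cross (m := 2 * k) (by omega)
  have hP3 := hP2.cross (m := 2 * k + 2) (by omega)
  have hP4 := hP3.cross (m := 2 * k + 1) (by omega)
  rw [copy_two_crossing]
  have hfin : cross (2 * k + 1) (cross (2 * k + 2) (cross (2 * k) (cross (2 * k + 1)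
      (double p n)))) = double q n' := by
    funext i
    simp only [cross]
    rw [swap_swap_swap_swap', swap_swap_swap_swap, double, double]
    have hq' := hq (Equiv.swap k (k + 1) (i / 2))
    have hn'' := hn' (Equiv.swap k (k + 1) (i / 2))
    rw [Equiv.swap_apply_self] at hq' hn''
    rw [hq', hn'', show (2 * Equiv.swap k (k + 1) (i / 2) + i % 2) / 2 =
      Equiv.swap k (k + 1) (i / 2) by omega]
    generalize (n (Equiv.swap k (k + 1) (i / 2))).val = x
    generalize p (Equiv.swap k (k + 1) (i / 2)) = y
    rw [show (2 * y + (2 * Equiv.swap k (k + 1) (i / 2) + i % 2 + x) % 2) / 2 = y by omega]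
    omega
  rw [← hfin]
  refine .crossing_pass hP (hE.ne (by omega) (by omega)) ?_
  refine .crossing_pass hP1 (hE1.ne (by omega) (by omega)) ?_
  refine .crossing_pass hP2 (hE2.ne (by omega) (by omega)) ?_
  refine .crossing_pass hP3 (hE3.ne (by omega) (by omega)) (.refl hP4)

theorem IsPairing.involutive {n : ℕ} {p : ℕ → ℕ} (h : IsPairing n p) (i : ℕ) : p (p i) = i := by
  by_cases hi : i < n
  · exact (h.1 i hi).2.2
  · rw [h.2 i (by omega), h.2 i (by omega)]

theorem toggle_apply {p : ℕ → ℕ} {m : ℕ → ZMod 2} (h : ∀ i, p (p i) = i) (j : ℕ)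
    (hm : ∀ i, m (p i) = m i) (i : ℕ) : toggle j p m (p i) = toggle j p m i := by
  have a1 : p i = p j ↔ i = j := ⟨fun h' => by rw [← h i, h', h], fun h' => by rw [h']⟩
  have a2 : p i = j ↔ i = p j := ⟨fun h' => by rw [← h', h], fun h' => by rw [h', h]⟩
  simp only [toggle, hm, a1, a2, or_comm]

theorem zmod_two_change {x y x' y' : ZMod 2}
    (h : x' + x = y' + y ∨ (x = 1 ∧ x' = 1) ∨ (y = 1 ∧ y' = 1)) :
    (x' = x ∧ y' = y) ∨ (x' = x + 1 ∧ y' = y + 1) ∨ (x' = x + 1 ∧ y' = y ∧ y = 1) ∨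
      (x' = x ∧ y' = y + 1 ∧ x = 1) := by
  revert x y x' y'; decide

-- The crossings at `2 * k` and `2 * k + 2`, if reached after a switch at `2 * k + 1`, each involve
-- the two copies of one strand. Following one changes the state of that pair; switching there
-- requires nested intervals, that is, state 1. The switches at `2 * k + 1` inherit normality from
-- the switch of `K`.
set_option maxHeartbeats 400000 in
theorem rulingPath_crossing_switch {w k : ℕ} {p : ℕ → ℕ} {n n' : ℕ → ZMod 2}
    (h : IsPairing w p) (hn : ∀ i, n (p i) = n i) (hw : ∀ i, w ≤ i → n i = 0)
    (hk : k + 2 ≤ w) (hpk : p k ≠ k + 1) (hN : IsNormal k p)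
    (hn' : ∀ i, n' (p i) = n' i)
    (hne : ∀ i, i ≠ k → i ≠ p k → i ≠ k + 1 → i ≠ p (k + 1) → n' i = n i)
    (hnk : n' k + n k = n' (k + 1) + n (k + 1) ∨ (n k = 1 ∧ n' k = 1) ∨
      (n (k + 1) = 1 ∧ n' (k + 1) = 1)) :
    RulingPath (2 * w) ((crossing k).copy 2) (double p n) (double p n') := by
  have hP := h.double hn hw
  have hE := isExternal_double (n := n) h hk hpk
  rw [h.isNormal_iff hk hpk] at hN
  rw [copy_two_crossing]
  have v0 := double_two_mul p n k
  have v1 := double_two_mul_add_one p n k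
  have v2 := double_two_mul p n (k + 1)
  have v3 := double_two_mul_add_one p n (k + 1)
  have b0 := ZMod.val_lt (n k)
  have b1 := ZMod.val_lt (n (k + 1))
  have e1 := h.1 k (by omega)
  have e2 := h.1 (k + 1) (by omega)
  have hpk' : p (k + 1) ≠ k := fun h3 => hpk (by rw [← e2.2.2, h3])
  have hpp : p k ≠ p (k + 1) := fun h4 => by
    have := e1.2.2
    rw [h4, e2.2.2] at this
    omega
  have w1 : 2 * (k + 1) = 2 * k + 2 := by ring
  have w2 : 2 * (k + 1) + 1 = 2 * k + 3 := by ring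
  rw [w1] at v2
  rw [w2] at v3
  have hc1 : cross (2 * k) (double p n) = double p (toggle k p n) := cross_double h (by omega)
  have hc2 : cross (2 * k + 2) (double p n) = double p (toggle (k + 1) p n) :=
    w1 ▸ cross_double h (by omega)
  have hc3 : cross (2 * k + 2) (cross (2 * k) (double p n)) =
      double p (toggle (k + 1) p (toggle k p n)) := by
    rw [hc1]
    exact w1 ▸ cross_double h (by omega)
  have hP0 := hP.cross (m := 2 * k) (by omega)
  have hP2 := hP.cross (m := 2 * k + 2) (by omega)
  have hP02 := hP0.cross (m := 2 * k + 2) (by omega)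
  have hE0 := hE.cross (m := 2 * k) (by omega) (by omega)
  have hE2 := hE.cross (m := 2 * k + 2) (by omega) (by omega)
  have hE02 := hE0.cross (m := 2 * k + 2) (by omega) (by omega)
  have hS1 : IsNormal (2 * k + 1) (double p n) := by
    refine hE.isNormal hP (by omega) (by omega) (by omega) ?_
    rw [show 2 * k + 1 + 1 = 2 * k + 2 by ring]
    omega
  -- States agree on companions and are prescribed off the two pairs, so their values at `k` and `k
  -- + 1` determine them.
  have hdet : ∀ m : ℕ → ZMod 2, (∀ i, m (p i) = m i) → m k = n' k → m (k + 1) = n' (k + 1) →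
      (∀ i, i ≠ k → i ≠ p k → i ≠ k + 1 → i ≠ p (k + 1) → m i = n i) → n' = m := by
    intro m h1 h2 h3 h4
    funext i
    by_cases i1 : i = k
    · rw [i1, h2]
    by_cases i2 : i = p k
    · rw [i2, h1, hn', h2]
    by_cases i3 : i = k + 1
    · rw [i3, h3]
    by_cases i4 : i = p (k + 1)
    · rw [i4, h1, hn', h3]
    rw [hne i i1 i2 i3 i4, h4 i i1 i2 i3 i4]
  have c00 := cross_apply_of_external hE (m := 2 * k) (i := 2 * k) (by omega) (by omega)
    (by omega) (by omega)
  have c01 := cross_apply_of_external hE (m := 2 * k) (i := 2 * k + 1) (by omega) (by omega)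
    (by omega) (by omega)
  have c02 := cross_apply_of_external hE (m := 2 * k) (i := 2 * k + 2) (by omega) (by omega)
    (by omega) (by omega)
  have c03 := cross_apply_of_external hE (m := 2 * k) (i := 2 * k + 3) (by omega) (by omega)
    (by omega) (by omega)
  have c21 := cross_apply_of_external hE (m := 2 * k + 2) (i := 2 * k + 1) (by omega) (by omega)
    (by omega) (by omega)
  have c22 := cross_apply_of_external hE (m := 2 * k + 2) (i := 2 * k + 2) (by omega) (by omega)
    (by omega) (by omega)
  rw [if_pos rfl] at c00 c22
  rw [if_neg (by omega), if_pos rfl] at c01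
  rw [if_neg (by omega), if_neg (by omega)] at c02 c03 c21
  have d1 := cross_apply_of_external hE0 (m := 2 * k + 2) (i := 2 * k + 1) (by omega) (by omega)
    (by omega) (by omega)
  have d2 := cross_apply_of_external hE0 (m := 2 * k + 2) (i := 2 * k + 2) (by omega) (by omega)
    (by omega) (by omega)
  rw [if_pos rfl] at d2
  rw [if_neg (by omega), if_neg (by omega)] at d1
  rw [show 2 * k + 2 + 1 = 2 * k + 3 by ring] at *
  have hS02 : IsNormal (2 * k + 1) (cross (2 * k + 2) (cross (2 * k) (double p n))) := by
    refine hE02.isNormal hP02 (by omega) (by omega) (by omega) ?_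
    rw [show 2 * k + 1 + 1 = 2 * k + 2 by ring, d1, d2, c01, c03]
    omega
  have hS0 : IsNormal (2 * k + 1) (cross (2 * k) (double p n)) := by
    refine hE0.isNormal hP0 (by omega) (by omega) (by omega) ?_
    rw [show 2 * k + 1 + 1 = 2 * k + 2 by ring, c01, c02]
    omega
  have hS2 : IsNormal (2 * k + 1) (cross (2 * k + 2) (double p n)) := by
    refine hE2.isNormal hP2 (by omega) (by omega) (by omega) ?_
    rw [show 2 * k + 1 + 1 = 2 * k + 2 by ring, c21, c22]
    omega
  -- none of the two pairs changes its state
  have path00 : RulingPath (2 * w) [crossing (2 * k + 1), crossing (2 * k), crossing (2 * k + 2),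
      crossing (2 * k + 1)] (double p n) (double p n) := by
    have hE1 := hE.cross (m := 2 * k + 1) (by omega) (by omega)
    have hP1 := hP.cross (m := 2 * k + 1) (by omega)
    have f0 := cross_apply_of_external hE (m := 2 * k + 1) (i := 2 * k) (by omega) (by omega)
      (by omega) (by omega)
    have f1 := cross_apply_of_external hE (m := 2 * k + 1) (i := 2 * k + 1) (by omega) (by omega)
      (by omega) (by omega)
    have f2 := cross_apply_of_external hE (m := 2 * k + 1) (i := 2 * k + 2) (by omega) (by omega)
      (by omega) (by omega)
    have f3 := cross_apply_of_external hE (m := 2 * k + 1) (i := 2 * k + 3) (by omega) (by omega)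
      (by omega) (by omega)
    rw [if_pos rfl] at f1
    rw [if_neg (by omega), if_pos rfl] at f2
    rw [if_neg (by omega), if_neg (by omega)] at f0 f3
    -- After the first crossing is followed, each of the two middle crossings involves one copy of
    -- each original strand, so it can be switched just as in `K`; the last crossing undoes the
    -- first.
    refine .crossing_pass hP (hE.ne (by omega) (by omega)) ?_
    refine .crossing_switch (hE1.ne (by omega) (by omega)) ?_ ?_
    · refine hE1.isNormal hP1 (by omega) (by omega) (by omega) ?_
      rw [f0, f1, show 2 * k + 1 + 1 = 2 * k + 2 by ring]
      omega
    refine .crossing_switch (hE1.ne (by omega) (by omega)) ?_ ?_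
    · refine hE1.isNormal hP1 (by omega) (by omega) (by omega) ?_
      rw [show 2 * k + 2 + 1 = 2 * k + 3 by ring, f2, f3]
      omega
    refine .crossing_pass hP1 (hE1.ne (by omega) (by omega)) ?_
    rw [cross_cross]
    exact .refl hP
  -- Both outer crossings of the list are switches here and in the next two paths; the middle ones
  -- are followed exactly for the pairs that change state.
  have path11 : RulingPath (2 * w) [crossing (2 * k + 1), crossing (2 * k), crossing (2 * k + 2),
      crossing (2 * k + 1)] (double p n) (double p (toggle (k + 1) p (toggle k p n))) := by
    rw [← hc3]
    refine .crossing_switch (hE.ne (by omega) (by omega)) hS1 ?_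
    refine .crossing_pass hP (hE.ne (by omega) (by omega)) ?_
    refine .crossing_pass hP0 (hE0.ne (by omega) (by omega)) ?_
    exact .crossing_switch (hE02.ne (by omega) (by omega)) hS02 (.refl hP02)
  have path10 : n (k + 1) = 1 → RulingPath (2 * w) [crossing (2 * k + 1), crossing (2 * k),
      crossing (2 * k + 2), crossing (2 * k + 1)] (double p n) (double p (toggle k p n)) := by
    intro h1
    rw [← hc1]
    refine .crossing_switch (hE.ne (by omega) (by omega)) hS1 ?_
    refine .crossing_pass hP (hE.ne (by omega) (by omega)) ?_
    refine .crossing_switch (hE0.ne (by omega) (by omega)) ?_ ?_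
    · refine hE0.isNormal hP0 (by omega) (by omega) (by omega) ?_
      rw [show 2 * k + 2 + 1 = 2 * k + 3 by ring, c02, c03, v2, v3, h1, ZMod.val_one]
      omega
    · exact .crossing_switch (hE0.ne (by omega) (by omega)) hS0 (.refl hP0)
  have path01 : n k = 1 → RulingPath (2 * w) [crossing (2 * k + 1), crossing (2 * k),
      crossing (2 * k + 2), crossing (2 * k + 1)] (double p n) (double p (toggle (k + 1) p n)) := by
    intro h1
    rw [← hc2]
    refine .crossing_switch (hE.ne (by omega) (by omega)) hS1 ?_
    refine .crossing_switch (hE.ne (by omega) (by omega)) ?_ ?_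
    · refine hE.isNormal hP (by omega) (by omega) (by omega) ?_
      rw [v0, v1, h1, ZMod.val_one]
      omega
    refine .crossing_pass hP (hE.ne (by omega) (by omega)) ?_
    exact .crossing_switch (hE2.ne (by omega) (by omega)) hS2 (.refl hP2)
  have t1 : ∀ m : ℕ → ZMod 2, toggle k p m k = m k + 1 := fun m => if_pos (Or.inl rfl)
  have t2 : ∀ m : ℕ → ZMod 2, toggle k p m (k + 1) = m (k + 1) := fun m => by
    rw [toggle, if_neg (by omega)]
  have t3 : ∀ m : ℕ → ZMod 2, toggle (k + 1) p m k = m k := fun m => by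
    rw [toggle, if_neg (by omega)]
  have t4 : ∀ m : ℕ → ZMod 2, toggle (k + 1) p m (k + 1) = m (k + 1) + 1 := fun m =>
    if_pos (Or.inl rfl)
  have t5 : ∀ (j : ℕ) (m : ℕ → ZMod 2), (∀ i, m (p i) = m i) →
      ∀ i, toggle j p m (p i) = toggle j p m i := fun j m => toggle_apply h.involutive j
  have t6 : ∀ (j i : ℕ) (m : ℕ → ZMod 2), i ≠ j → i ≠ p j → toggle j p m i = m i :=
    fun j i m h1 h2 => by rw [toggle, if_neg (by tauto)]
  rcases zmod_two_change hnk with ⟨h1, h2⟩ | ⟨h1, h2⟩ | ⟨h1, h2, h3⟩ | ⟨h1, h2, h3⟩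
  · rwa [hdet n hn h1.symm h2.symm fun i _ _ _ _ => rfl]
  · rwa [hdet _ (t5 (k + 1) _ (t5 k n hn)) (by rw [t3, t1, h1]) (by rw [t4, t2, h2])
      fun i h1 h2 h3 h4 => by rw [t6 _ _ _ h3 h4, t6 _ _ _ h1 h2]]
  · rw [hdet _ (t5 k n hn) (by rw [t1, h1]) (by rw [t2, h2]) fun i h1 h2 _ _ => t6 _ _ _ h1 h2]
    exact path10 h3
  · rw [hdet _ (t5 (k + 1) n hn) (by rw [t3, h1]) (by rw [t4, h2]) fun i _ _ h3 h4 => t6 _ _ _ h3 h4]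
    exact path01 h3

/-- Following the crossing exchanges the two copies and changes the state. In state 1 the two
intervals are nested, so the crossing may be a switch instead; in state 0 they interleave and it may
not. -/
theorem rulingPath_base {w k : ℕ} {p : ℕ → ℕ} {n n' : ℕ → ZMod 2}
    (h : IsPairing w p) (hn : ∀ i, n (p i) = n i) (hw : ∀ i, w ≤ i → n i = 0)
    (hk : k < w) (hn' : ∀ i, n' (p i) = n' i) (hne : ∀ i, i ≠ k → i ≠ p k → n' i = n i)
    (hnk : n' k = n k + 1 ∨ (n k = 1 ∧ n' k = 1)) :
    RulingPath (2 * w) [crossing (2 * k)] (double p n) (double p n') := by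
  have hP := h.double hn hw
  have hk' := h.1 k hk
  have hdk := double_two_mul p n k
  have hdk' := double_two_mul_add_one p n k
  have hm : double p n (2 * k) ≠ 2 * k + 1 := by
    have := ZMod.val_lt (n k)
    omega
  rcases hnk with h1 | ⟨h1, h2⟩
  · refine .crossing_pass hP hm ?_
    have : double p n' = cross (2 * k) (double p n) := by
      rw [cross_double h hk]
      congr 1
      funext i
      rw [toggle]
      split_ifs with hi
      · rcases hi with rfl | rfl
        · exact h1
        · rw [hn', h1, hn]
      · push Not at hi
        exact hne i hi.1 hi.2
    rw [this]
    exact .refl (hP.cross (by omega))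
  · have : n' = n := by
      funext i
      by_cases hi : i = k
      · rw [hi, h1, h2]
      by_cases hi' : i = p k
      · rw [hi', hn', hn, h1, h2]
      exact hne i hi hi'
    rw [this]
    refine .crossing_switch hm ?_ (.refl hP)
    rw [hP.isNormal_iff (by omega) hm, hdk, hdk', h1, ZMod.val_one]
    omega

/-! ### Cusps in the 2-copy -/

/-- Insertion of a left cusp at place `k` into a ruling. -/
def insertCusp (k : ℕ) (p : ℕ → ℕ) (i : ℕ) : ℕ :=
  if i < k then skip k (p i) else if i = k then k + 1 else if i = k + 1 then k
  else skip k (p (i - 2))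

theorem skip_cases (k i : ℕ) : (i < k ∧ skip k i = i) ∨ (k ≤ i ∧ skip k i = i + 2) := by
  rw [skip]; split_ifs <;> omega

theorem insertCusp_skip (k : ℕ) (p : ℕ → ℕ) (i : ℕ) :
    insertCusp k p (skip k i) = skip k (p i) := by
  rcases skip_cases k i with h | h <;> rw [h.2, insertCusp]
  · rw [if_pos h.1]
  · rw [if_neg (by omega), if_neg (by omega), if_neg (by omega), Nat.add_sub_cancel]

theorem insertCusp_self (k : ℕ) (p : ℕ → ℕ) : insertCusp k p k = k + 1 := by simp [insertCusp]

theorem insertCusp_succ (k : ℕ) (p : ℕ → ℕ) : insertCusp k p (k + 1) = k := by simp [insertCusp]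

theorem eq_skip (k i : ℕ) : i = k ∨ i = k + 1 ∨ ∃ j, i = skip k j := by
  by_cases h : i < k
  · exact Or.inr (Or.inr ⟨i, by rw [skip, if_pos h]⟩)
  by_cases h1 : i = k
  · exact Or.inl h1
  by_cases h2 : i = k + 1
  · exact Or.inr (Or.inl h2)
  · exact Or.inr (Or.inr ⟨i - 2, by rw [skip, if_neg (by omega)]; omega⟩)

theorem skip_injective (k : ℕ) : Function.Injective (skip k) := by
  intro i j h
  simp only [skip] at h
  split_ifs at h <;> omega

theorem skip_lt_iff {k n i : ℕ} (hk : k ≤ n) : skip k i < n + 2 ↔ i < n := by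
  rw [skip]; split_ifs <;> omega

theorem IsPairing.insertCusp {n k : ℕ} {p : ℕ → ℕ} (h : IsPairing n p) (hk : k ≤ n) :
    IsPairing (n + 2) (insertCusp k p) := by
  refine ⟨fun i hi => ?_, fun i hi => ?_⟩
  · rcases eq_skip k i with rfl | rfl | ⟨j, rfl⟩
    · rw [insertCusp_self, insertCusp_succ]; omega
    · rw [insertCusp_succ, insertCusp_self]; omega
    · rw [skip_lt_iff hk] at hi
      rw [insertCusp_skip, insertCusp_skip, skip_lt_iff hk, (skip_injective k).ne_iff, (h.1 j hi).2.2]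
      exact ⟨(h.1 j hi).1, (h.1 j hi).2.1, rfl⟩
  · rcases eq_skip k i with rfl | rfl | ⟨j, rfl⟩
    · omega
    · omega
    · rw [insertCusp_skip, h.2 j]
      by_contra hj
      have := (skip_lt_iff hk).2 (not_le.1 hj)
      omega

theorem RulingPath.leftCusp {n k : ℕ} {l : List Event} {p q : ℕ → ℕ} (hp : IsPairing n p)
    (h : RulingPath (n + 2) l (insertCusp k p) q) :
    RulingPath n (leftCusp k :: l) p q :=
  ⟨hp, _, ⟨insertCusp_self k p, insertCusp_skip k p⟩, h⟩

/-- The two cusps create the order upper, lower, upper, lower. Following the crossing makes it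
upper, upper, lower, lower with first paired to first, which is state 0. -/
theorem rulingPath_leftCusp {w k : ℕ} {p q : ℕ → ℕ} {n n' : ℕ → ZMod 2}
    (h : IsPairing w p) (hn : ∀ i, n (p i) = n i) (hw : ∀ i, w ≤ i → n i = 0)
    (hk : k ≤ w) (hqk : q k = k + 1) (hqk' : q (k + 1) = k)
    (hq : ∀ i, q (skip k i) = skip k (p i)) (hn' : ∀ i, n' (skip k i) = n i)
    (h0 : n' k = 0) (h1 : n' (k + 1) = 0) :
    RulingPath (2 * w) ((Event.leftCusp k).copy 2) (double p n) (double q n') := by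
  have hP := h.double hn hw
  have hP1 := hP.insertCusp (k := 2 * k) (by omega)
  have hP2 := hP1.insertCusp (k := 2 * k + 2) (by omega)
  have hP3 := hP2.cross (m := 2 * k + 1) (by omega)
  rw [copy_two_leftCusp]
  refine .leftCusp hP (.leftCusp hP1 (.crossing_pass hP2 ?_ ?_))
  · have : 2 * k + 1 = skip (2 * k + 2) (2 * k + 1) := by rw [skip, if_pos (by omega)]
    rw [this, insertCusp_skip, ← this, insertCusp_succ, skip, if_pos (by omega)]
    omega
  have : cross (2 * k + 1) (insertCusp (2 * k + 2) (insertCusp (2 * k) (double p n))) =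
      double q n' := by
    rw [cross_eq_iff]
    have e0 : skip (2 * k + 2) (2 * k) = 2 * k := by rw [skip, if_pos (by omega)]
    have e1 : skip (2 * k + 2) (2 * k + 1) = 2 * k + 1 := by rw [skip, if_pos (by omega)]
    have s2 : Equiv.swap (2 * k + 1) (2 * k + 1 + 1) (2 * k + 2) = 2 * k + 1 :=
      Equiv.swap_apply_right _ _
    have s3 : Equiv.swap (2 * k + 1) (2 * k + 1 + 1) (2 * k + 3) = 2 * k + 3 :=
      Equiv.swap_apply_of_ne_of_ne (by omega) (by omega)
    have s0 : Equiv.swap (2 * k + 1) (2 * k + 1 + 1) (2 * k) = 2 * k :=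
      Equiv.swap_apply_of_ne_of_ne (by omega) (by omega)
    have s1 : Equiv.swap (2 * k + 1) (2 * k + 1 + 1) (2 * k + 1) = 2 * (k + 1) :=
      Equiv.swap_apply_left _ _
    have s1' : Equiv.swap (2 * k + 1) (2 * k + 1 + 1) (2 * k + 1) = 2 * k + 2 := s1
    intro i
    rcases eq_skip (2 * k + 2) i with rfl | rfl | ⟨i, rfl⟩
    · rw [insertCusp_self, s2, s3, double_two_mul_add_one, hqk, h0, ZMod.val_zero]
      omega
    · rw [insertCusp_succ, s3, s2, show 2 * k + 3 = 2 * (k + 1) + 1 by ring,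
        double_two_mul_add_one, hqk', h1, ZMod.val_zero]
      omega
    rw [insertCusp_skip]
    rcases eq_skip (2 * k) i with rfl | rfl | ⟨i, rfl⟩
    · rw [insertCusp_self, e0, e1, s0, s1, double_two_mul, hqk, h0, ZMod.val_zero]
      omega
    · rw [insertCusp_succ, e0, e1, s0, s1, double_two_mul, hqk', h1, ZMod.val_zero]
      omega
    have e : ∀ j, skip (2 * k + 2) (skip (2 * k) j) = 2 * skip k (j / 2) + j % 2 := by
      intro j
      simp only [skip]
      split_ifs <;> omega
    have e' : ∀ j, Equiv.swap (2 * k + 1) (2 * k + 1 + 1) (2 * skip k (j / 2) + j % 2) =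
        2 * skip k (j / 2) + j % 2 := by
      intro j
      rcases skip_cases k (j / 2) with h | h <;> rw [h.2] <;>
        exact Equiv.swap_apply_of_ne_of_ne (by omega) (by omega)
    rw [insertCusp_skip, e, e, e', e', double, show ∀ x y, (2 * x + y % 2) / 2 = x by omega, hq, hn',
      double, show ∀ x y, (2 * x + y % 2) / 2 = x by omega]
    omega
  rw [this]
  exact .refl (this ▸ hP3)

theorem Passes.reflect {e : Event} {p q : ℕ → ℕ} (h : Passes e p q)
    (hp : ∀ i, p (p i) = i) : Passes e.reflect q p := by
  cases e with
  | leftCusp k => exact h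
  | rightCusp k => exact h
  | crossing k =>
    obtain ⟨h1, h2 | ⟨rfl, h2⟩⟩ := h
    · refine ⟨fun h3 => h1 ?_, Or.inl fun i => ?_⟩
      · have := h2 (k + 1)
        rw [Equiv.swap_apply_right, h3, eq_comm, Equiv.swap_apply_def] at this
        have h4 : p (k + 1) = k := by
          split_ifs at this <;> omega
        rw [← h4, hp, h4]
      · have := h2 (Equiv.swap k (k + 1) i)
        rw [Equiv.swap_apply_self] at this
        rw [this, Equiv.swap_apply_self]
    · exact ⟨h1, Or.inr ⟨rfl, h2⟩⟩

theorem strandsAfter_append (n : ℕ) (l l' : List Event) :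
    strandsAfter n (l ++ l') = strandsAfter (strandsAfter n l) l' := List.foldl_append

theorem IsTangle.strandsAfter_eq {n m : ℕ} {l : List Event} (h : IsTangle n l m) :
    strandsAfter n l = m := by
  induction l generalizing n with
  | nil => exact h
  | cons e l ih => exact ih h.2

theorem RulingPath.reflect {n m : ℕ} {l : List Event} {p q : ℕ → ℕ} (h : RulingPath n l p q)
    (hl : IsTangle n l m) : RulingPath m (l.map Event.reflect).reverse q p := by
  induction l generalizing n p with
  | nil =>
    obtain ⟨h1, rfl⟩ := h
    cases hl
    exact ⟨h1, rfl⟩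
  | cons e l ih =>
    obtain ⟨h1, r, hr, h2⟩ := h
    rw [List.map_cons, List.reverse_cons]
    refine (ih h2 hl.2).append hl.2.reflect.strandsAfter_eq ⟨h2.isPairing_left, p,
      hr.reflect h1.involutive, ?_⟩
    have : e.reflect.out (e.out n) = n :=
      (IsTangle.reflect (l := [e]) (a := n) ⟨hl.1, rfl⟩).2
    exact ⟨this.symm ▸ h1, rfl⟩

theorem rulingPath_rightCusp {w k : ℕ} {p q : ℕ → ℕ} {n n' : ℕ → ZMod 2}
    (h : IsPairing w q) (hn : ∀ i, n' (q i) = n' i) (hw : ∀ i, w ≤ i → n' i = 0)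
    (hk : k ≤ w) (hpk : p k = k + 1) (hpk' : p (k + 1) = k)
    (hp : ∀ i, p (skip k i) = skip k (q i)) (hn' : ∀ i, n (skip k i) = n' i)
    (h0 : n k = 0) (h1 : n (k + 1) = 0) :
    RulingPath (2 * (w + 2)) ((Event.rightCusp k).copy 2) (double p n) (double q n') :=
  (rulingPath_leftCusp h hn hw hk hpk hpk' hp hn' h0 h1).reflect (isTangle_copyLeftCusp 2 w k hk)

/-! ### The disks of a normal ruling -/

/-- The pairings `r g` over the gaps `g` form a normal ruling of the front in the plane with events
`l`, which has `w g` strands over the gap `g`. -/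
structure Ruled (l : List Event) (w : ℕ → ℕ) (r : ℕ → ℕ → ℕ) : Prop where
  width_zero : w 0 = 0
  width_length : w l.length = 0
  fits : ∀ (j : ℕ) (hj : j < l.length), l[j].Fits (w j)
  out : ∀ (j : ℕ) (hj : j < l.length), w (j + 1) = l[j].out (w j)
  isPairing : ∀ g ≤ l.length, IsPairing (w g) (r g)
  passes : ∀ (j : ℕ) (hj : j < l.length), Passes l[j] (r j) (r (j + 1))

open Classical in
/-- The left cusp at which the disk of the ruling containing the `i`-th strand over the gap `g`
begins. -/
noncomputable def label (l : List Event) (r : ℕ → ℕ → ℕ) : ℕ → ℕ → ℕ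
  | 0, _ => 0
  | j + 1, i =>
    match l[j]? with
    | some (leftCusp k) =>
      if i < k then label l r j i else if i < k + 2 then j else label l r j (i - 2)
    | some (rightCusp k) => label l r j (skip k i)
    | some (crossing k) =>
      if r j = r (j + 1) then label l r j i else label l r j (Equiv.swap k (k + 1) i)
    | none => 0

section

variable {l : List Event} {r : ℕ → ℕ → ℕ} {j k : ℕ}

theorem label_leftCusp_skip (h : l[j]? = some (leftCusp k)) (i : ℕ) :
    label l r (j + 1) (skip k i) = label l r j i := by
  rw [label, h]
  dsimp only
  rcases skip_cases k i with hi | hi <;> rw [hi.2]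
  · rw [if_pos hi.1]
  · rw [if_neg (by omega), if_neg (by omega), Nat.add_sub_cancel]

theorem label_leftCusp_self (h : l[j]? = some (leftCusp k)) : label l r (j + 1) k = j := by
  rw [label, h]; simp

theorem label_leftCusp_succ (h : l[j]? = some (leftCusp k)) :
    label l r (j + 1) (k + 1) = j := by
  rw [label, h]; simp

theorem label_rightCusp (h : l[j]? = some (rightCusp k)) (i : ℕ) :
    label l r (j + 1) i = label l r j (skip k i) := by
  rw [label, h]

theorem label_switch (h : l[j]? = some (crossing k)) (hr : r j = r (j + 1)) (i : ℕ) :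
    label l r (j + 1) i = label l r j i := by
  rw [label, h]; simp [hr]

theorem label_followed (h : l[j]? = some (crossing k)) (hr : r j ≠ r (j + 1)) (i : ℕ) :
    label l r (j + 1) (Equiv.swap k (k + 1) i) = label l r j i := by
  rw [label, h]; simp [hr]

end

theorem swap_succ_lt {k n i : ℕ} (hk : k + 2 ≤ n) (hi : i < n) :
    Equiv.swap k (k + 1) i < n := by
  rw [swap_succ_apply]
  split_ifs <;> omega

/-- The states of the strands over a gap, given the states `N g` of the disks over the gap `g`. -/
noncomputable def strandState (l : List Event) (w : ℕ → ℕ) (r : ℕ → ℕ → ℕ) (N : ℕ → ℕ → ZMod 2)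
    (g i : ℕ) : ZMod 2 := if i < w g then N g (label l r g i) else 0

theorem strandState_of_le {l : List Event} {w : ℕ → ℕ} {r : ℕ → ℕ → ℕ} (N : ℕ → ℕ → ZMod 2)
    (g i : ℕ) (hi : w g ≤ i) : strandState l w r N g i = 0 := if_neg (by omega)

namespace Ruled

variable {l : List Event} {w : ℕ → ℕ} {r : ℕ → ℕ → ℕ} (H : Ruled l w r) {j k : ℕ}

include H

theorem leftCusp_data (h : l[j]? = some (leftCusp k)) :
    j < l.length ∧ k ≤ w j ∧ w (j + 1) = w j + 2 ∧ r (j + 1) k = k + 1 ∧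
      r (j + 1) (k + 1) = k ∧ ∀ i, r (j + 1) (skip k i) = skip k (r j i) := by
  obtain ⟨hj, h⟩ := List.getElem?_eq_some_iff.1 h
  have h1 := H.fits j hj
  have h2 := H.out j hj
  have h3 := H.passes j hj
  rw [h] at h1 h2 h3
  refine ⟨hj, h1, h2, h3.1, ?_, h3.2⟩
  rw [← h3.1, (H.isPairing (j + 1) hj).involutive]

theorem rightCusp_data (h : l[j]? = some (rightCusp k)) :
    j < l.length ∧ k ≤ w (j + 1) ∧ w j = w (j + 1) + 2 ∧ r j k = k + 1 ∧
      r j (k + 1) = k ∧ ∀ i, r j (skip k i) = skip k (r (j + 1) i) := by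
  obtain ⟨hj, h⟩ := List.getElem?_eq_some_iff.1 h
  have h1 := H.fits j hj
  have h2 := H.out j hj
  have h3 := H.passes j hj
  rw [h] at h1 h2 h3
  simp only [Fits, Event.out] at h1 h2
  refine ⟨hj, by omega, by omega, h3.1, ?_, h3.2⟩
  rw [← h3.1, (H.isPairing j hj.le).involutive]

/-- A followed crossing must alter the pairing: otherwise `k` and `k + 1` would have the same
companion. Hence `r j = r (j + 1)` characterizes switches. -/
theorem crossing_data (h : l[j]? = some (crossing k)) :
    j < l.length ∧ k + 2 ≤ w j ∧ w (j + 1) = w j ∧ r j k ≠ k + 1 ∧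
      (r j = r (j + 1) → IsNormal k (r j)) ∧ (r j ≠ r (j + 1) →
        ∀ i, r (j + 1) (Equiv.swap k (k + 1) i) = Equiv.swap k (k + 1) (r j i)) := by
  obtain ⟨hj, h⟩ := List.getElem?_eq_some_iff.1 h
  have h1 := H.fits j hj
  have h2 := H.out j hj
  have h3 := H.passes j hj
  rw [h] at h1 h2 h3
  refine ⟨hj, h1, h2, h3.1, fun h4 => ?_, fun h4 => ?_⟩
  · rcases h3.2 with h5 | h5
    · exfalso
      rw [← h4] at h5
      have h6 := h5 k
      rw [Equiv.swap_apply_left] at h6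
      have h7 := (H.isPairing j hj.le).involutive (k + 1)
      have h8 := ((H.isPairing j hj.le).1 k (by simp only [Fits] at h1; omega)).2.1
      rw [Equiv.swap_apply_of_ne_of_ne h8 h3.1] at h6
      rw [h6, (H.isPairing j hj.le).involutive k] at h7
      omega
    · exact h5.2
  · rcases h3.2 with h5 | h5
    · exact h5
    · exact absurd h5.1.symm h4

theorem label_succ_cases (hj : j < l.length) {i : ℕ} (hi : i < w (j + 1)) :
    (label l r (j + 1) i = j ∧ ∃ k, l[j]? = some (leftCusp k)) ∨
      ∃ i' < w j, label l r (j + 1) i = label l r j i' := by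
  rcases he : l[j] with k | k | k <;> have he' : l[j]? = some _ := List.getElem?_eq_some_iff.2 ⟨hj, he⟩
  · obtain ⟨-, h1, h2, -⟩ := H.leftCusp_data he'
    rcases eq_skip k i with rfl | rfl | ⟨i, rfl⟩
    · exact Or.inl ⟨label_leftCusp_self he', _, he'⟩
    · exact Or.inl ⟨label_leftCusp_succ he', _, he'⟩
    · rw [h2, skip_lt_iff h1] at hi
      exact Or.inr ⟨i, hi, label_leftCusp_skip he' i⟩
  · obtain ⟨-, h1, h2, -⟩ := H.rightCusp_data he'
    exact Or.inr ⟨skip k i, by rwa [h2, skip_lt_iff h1], label_rightCusp he' i⟩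
  · obtain ⟨-, h1, h2, -⟩ := H.crossing_data he'
    right
    rw [h2] at hi
    by_cases hr : r j = r (j + 1)
    · exact ⟨i, hi, label_switch he' hr i⟩
    · refine ⟨_, swap_succ_lt h1 hi, ?_⟩
      rw [← label_followed he' hr, Equiv.swap_apply_self]

theorem label_lt {g : ℕ} (hg : g ≤ l.length) {i : ℕ} (hi : i < w g) :
    label l r g i < g ∧ ∃ k, l[label l r g i]? = some (leftCusp k) := by
  induction g generalizing i with
  | zero => rw [H.width_zero] at hi; omega
  | succ g ih =>
    rcases H.label_succ_cases hg hi with ⟨h1, h2⟩ | ⟨i', hi', h1⟩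
    · rw [h1]
      exact ⟨Nat.lt_succ_self g, h2⟩
    · rw [h1]
      have := ih (by omega) hi'
      exact ⟨by omega, this.2⟩

theorem label_companion {g : ℕ} (hg : g ≤ l.length) (i : ℕ) :
    label l r g (r g i) = label l r g i := by
  induction g generalizing i with
  | zero => rfl
  | succ j ih =>
    have hj : j < l.length := hg
    rcases he : l[j] with k | k | k <;>
      have he' : l[j]? = some _ := List.getElem?_eq_some_iff.2 ⟨hj, he⟩
    · obtain ⟨-, -, -, h1, h2, h3⟩ := H.leftCusp_data he'
      rcases eq_skip k i with rfl | rfl | ⟨i, rfl⟩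
      · rw [h1, label_leftCusp_self he', label_leftCusp_succ he']
      · rw [h2, label_leftCusp_self he', label_leftCusp_succ he']
      · rw [h3, label_leftCusp_skip he', label_leftCusp_skip he', ih hj.le]
    · obtain ⟨-, -, -, h1, h2, h3⟩ := H.rightCusp_data he'
      rw [label_rightCusp he', label_rightCusp he', ← h3, ih hj.le]
    · obtain ⟨-, -, -, -, -, h3⟩ := H.crossing_data he'
      by_cases hr : r j = r (j + 1)
      · rw [label_switch he' hr, label_switch he' hr, ← hr, ih hj.le]
      · obtain ⟨i, rfl⟩ := (Equiv.swap k (k + 1)).surjective i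
        rw [h3 hr, label_followed he' hr, label_followed he' hr, ih hj.le]

/-- A disk meets a vertical line in at most one pair: a left cusp introduces the fresh label `j`,
while older labels are smaller. -/
theorem eq_of_label_eq {g : ℕ} (hg : g ≤ l.length) {i i' : ℕ} (hi : i < w g) (hi' : i' < w g)
    (h : label l r g i = label l r g i') : i' = i ∨ i' = r g i := by
  induction g generalizing i i' with
  | zero => rw [H.width_zero] at hi; omega
  | succ j ih =>
    have hj : j < l.length := hg
    rcases he : l[j] with k | k | k <;>
      have he' : l[j]? = some _ := List.getElem?_eq_some_iff.2 ⟨hj, he⟩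
    · obtain ⟨-, h4, h5, h1, h2, h3⟩ := H.leftCusp_data he'
      have hne : ∀ i < w j, label l r j i ≠ j := fun i hi => (H.label_lt hj.le hi).1.ne
      rw [h5] at hi hi'
      rcases eq_skip k i with e1 | e1 | ⟨i, rfl⟩ <;>
        rcases eq_skip k i' with e2 | e2 | ⟨i', rfl⟩
      · exact Or.inl (e2.trans e1.symm)
      · exact Or.inr (by rw [e1, e2, h1])
      · rw [skip_lt_iff h4] at hi'
        rw [e1, label_leftCusp_self he', label_leftCusp_skip he'] at h
        exact absurd h.symm (hne i' hi')
      · exact Or.inr (by rw [e1, e2, h2])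
      · exact Or.inl (e2.trans e1.symm)
      · rw [skip_lt_iff h4] at hi'
        rw [e1, label_leftCusp_succ he', label_leftCusp_skip he'] at h
        exact absurd h.symm (hne i' hi')
      · rw [skip_lt_iff h4] at hi
        rw [e2, label_leftCusp_self he', label_leftCusp_skip he'] at h
        exact absurd h (hne i hi)
      · rw [skip_lt_iff h4] at hi
        rw [e2, label_leftCusp_succ he', label_leftCusp_skip he'] at h
        exact absurd h (hne i hi)
      · rw [skip_lt_iff h4] at hi hi'
        rw [label_leftCusp_skip he', label_leftCusp_skip he'] at h
        rw [h3, (skip_injective k).eq_iff, (skip_injective k).eq_iff]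
        exact ih hj.le hi hi' h
    · obtain ⟨-, h4, h5, h1, h2, h3⟩ := H.rightCusp_data he'
      rw [label_rightCusp he', label_rightCusp he'] at h
      have := ih hj.le (by rwa [h5, skip_lt_iff h4]) (by rwa [h5, skip_lt_iff h4]) h
      rwa [h3, (skip_injective k).eq_iff, (skip_injective k).eq_iff] at this
    · obtain ⟨-, h4, h5, -, -, h3⟩ := H.crossing_data he'
      rw [h5] at hi hi'
      by_cases hr : r j = r (j + 1)
      · rw [label_switch he' hr, label_switch he' hr] at h
        rw [← hr]
        exact ih hj.le hi hi' h
      · have e1 := swap_succ_lt h4 hi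
        have e2 := swap_succ_lt h4 hi'
        obtain ⟨i, rfl⟩ := (Equiv.swap k (k + 1)).surjective i
        obtain ⟨i', rfl⟩ := (Equiv.swap k (k + 1)).surjective i'
        rw [Equiv.swap_apply_self] at e1 e2
        rw [label_followed he' hr, label_followed he' hr] at h
        rw [h3 hr, (Equiv.injective _).eq_iff, (Equiv.injective _).eq_iff]
        exact ih hj.le e1 e2 h

/-- A disk that has ended does not reappear: the right cusp removes the only pair with its label,
and later left cusps create larger labels. -/
theorem label_ne_of_rightCusp (h : l[j]? = some (rightCusp k)) {g : ℕ} (hjg : j < g)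
    (hg : g ≤ l.length) {i : ℕ} (hi : i < w g) : label l r g i ≠ label l r j k := by
  obtain ⟨hj, h4, h5, h1, h2, h3⟩ := H.rightCusp_data h
  induction g, hjg using Nat.le_induction generalizing i with
  | base =>
    rw [label_rightCusp h]
    intro h6
    have := H.eq_of_label_eq hj.le (by rwa [h5, skip_lt_iff h4]) (by omega) h6
    rcases skip_cases k i with h7 | h7 <;> rw [h7.2] at this
    · have h8 := H.eq_of_label_eq hj.le (i := k) (i' := skip k i) (by omega)
        (by rwa [h5, skip_lt_iff h4]) h6.symm
      rw [h1, h7.2] at h8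
      omega
    · have h8 := H.eq_of_label_eq hj.le (i := k) (i' := skip k i) (by omega)
        (by rwa [h5, skip_lt_iff h4]) h6.symm
      rw [h1, h7.2] at h8
      omega
  | succ g hg' ih =>
    rcases H.label_succ_cases hg hi with ⟨h6, -⟩ | ⟨i', hi', h6⟩
    · have := (H.label_lt hj.le (i := k) (by omega)).1
      omega
    · rw [h6]
      exact ih (by omega) hi'

theorem strandState_companion (N : ℕ → ℕ → ZMod 2) {g : ℕ} (hg : g ≤ l.length) (i : ℕ) :
    strandState l w r N g (r g i) = strandState l w r N g i := by
  have hp := H.isPairing g hg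
  rw [strandState, strandState, H.label_companion hg]
  by_cases hi : i < w g
  · rw [if_pos hi, if_pos (hp.1 i hi).1]
  · rw [hp.2 i (by omega)]

/-- Reduces the local models to conditions on the states of disks: 0 at birth and death, constant
away from switches, and an admissible change at switches. -/
theorem rulingPath_copy (N : ℕ → ℕ → ZMod 2) (hj : j < l.length)
    (hleft : ∀ k, l[j]? = some (leftCusp k) → N (j + 1) j = 0)
    (hright : ∀ k, l[j]? = some (rightCusp k) → N j (label l r j k) = 0)
    (hsame : ∀ v, ¬ ((∃ k, l[j]? = some (crossing k)) ∧ r j = r (j + 1)) → N (j + 1) v = N j v)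
    (hswitch : ∀ k, l[j]? = some (crossing k) → r j = r (j + 1) →
      (∀ v, v ≠ label l r j k → v ≠ label l r j (k + 1) → N (j + 1) v = N j v) ∧
      (N (j + 1) (label l r j k) + N j (label l r j k) =
        N (j + 1) (label l r j (k + 1)) + N j (label l r j (k + 1)) ∨
        (N j (label l r j k) = 1 ∧ N (j + 1) (label l r j k) = 1) ∨
        (N j (label l r j (k + 1)) = 1 ∧ N (j + 1) (label l r j (k + 1)) = 1))) :
    RulingPath (2 * w j) (l[j].copy 2) (double (r j) (strandState l w r N j))
      (double (r (j + 1)) (strandState l w r N (j + 1))) := by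
  have hp := H.isPairing j hj.le
  have hp' := H.isPairing (j + 1) hj
  have hs := H.strandState_companion N hj.le
  have hs' := H.strandState_companion N (g := j + 1) hj
  have h0 := strandState_of_le (l := l) (w := w) (r := r) N j
  have h0' := strandState_of_le (l := l) (w := w) (r := r) N (j + 1)
  rcases he : l[j] with k | k | k <;>
    have he' : l[j]? = some _ := List.getElem?_eq_some_iff.2 ⟨hj, he⟩
  · obtain ⟨-, h4, h5, h1, h2, h3⟩ := H.leftCusp_data he'
    refine rulingPath_leftCusp hp hs h0 h4 h1 h2 h3 (fun i => ?_) ?_ ?_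
    · rw [strandState, strandState, h5, label_leftCusp_skip he', hsame _ (by simp [he'])]
      simp only [skip_lt_iff h4]
    · rw [strandState, label_leftCusp_self he', hleft k he', ite_self]
    · rw [strandState, label_leftCusp_succ he', hleft k he', ite_self]
  · obtain ⟨-, h4, h5, h1, h2, h3⟩ := H.rightCusp_data he'
    rw [h5]
    refine rulingPath_rightCusp hp' hs' h0' h4 h1 h2 h3 (fun i => ?_) ?_ ?_
    · rw [strandState, strandState, h5, label_rightCusp he', hsame _ (by simp [he'])]
      simp only [skip_lt_iff h4]
    · rw [strandState, hright k he', ite_self]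
    · rw [← h1, hs, strandState, hright k he', ite_self]
  · obtain ⟨-, h4, h5, h1, h2, h3⟩ := H.crossing_data he'
    by_cases hr : r j = r (j + 1)
    · obtain ⟨h6, h7⟩ := hswitch k he' hr
      have e : ∀ i, i < w j → strandState l w r N j i = N j (label l r j i) := fun i hi => if_pos hi
      have e' : ∀ i, i < w j → strandState l w r N (j + 1) i = N (j + 1) (label l r j i) :=
        fun i hi => by rw [strandState, h5, if_pos hi, label_switch he' hr]
      rw [← hr] at hs' ⊢
      refine rulingPath_crossing_switch hp hs h0 h4 h1 (h2 hr) hs' (fun i i1 i2 i3 i4 => ?_) ?_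
      · by_cases hi : i < w j
        · rw [e i hi, e' i hi]
          refine h6 _ (fun h => ?_) fun h => ?_
          · rcases H.eq_of_label_eq hj.le (by omega) hi h.symm with h | h
            · exact i1 h
            · exact i2 h
          · rcases H.eq_of_label_eq hj.le (by omega) hi h.symm with h | h
            · exact i3 h
            · exact i4 h
        · rw [h0 i (by omega), h0' i (by omega)]
      · rw [e k (by omega), e' k (by omega), e (k + 1) (by omega), e' (k + 1) (by omega)]
        exact h7
    · refine rulingPath_crossing_followed hp hs h0 h4 h1 (h3 hr) fun i => ?_
      rw [strandState, strandState, h5, label_followed he' hr, hsame _ (fun h => hr h.2)]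
      have : Equiv.swap k (k + 1) i < w j ↔ i < w j :=
        ⟨fun h => by simpa using swap_succ_lt h4 h, swap_succ_lt h4⟩
      simp only [this]

theorem isTangle_segment (g d : ℕ) (hd : g + d ≤ l.length) :
    IsTangle (w g) ((l.drop g).take d) (w (g + d)) := by
  induction d with
  | zero => simp [IsTangle]
  | succ d ih =>
    rw [List.take_succ_eq_append_getElem (by rw [List.length_drop]; omega)]
    refine (ih (by omega)).append ⟨?_, ?_⟩
    · simpa using H.fits (g + d) (by omega)
    · simpa [IsTangle, ← add_assoc] using (H.out (g + d) (by omega)).symm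

theorem rulingPath_segment (N : ℕ → ℕ → ZMod 2) (g d : ℕ) (hd : g + d ≤ l.length)
    (hleft : ∀ j k, g ≤ j → j < g + d → l[j]? = some (leftCusp k) → N (j + 1) j = 0)
    (hright : ∀ j k, g ≤ j → j < g + d → l[j]? = some (rightCusp k) → N j (label l r j k) = 0)
    (hsame : ∀ j v, g ≤ j → j < g + d →
      ¬ ((∃ k, l[j]? = some (crossing k)) ∧ r j = r (j + 1)) → N (j + 1) v = N j v)
    (hswitch : ∀ j k, g ≤ j → j < g + d → l[j]? = some (crossing k) → r j = r (j + 1) →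
      (∀ v, v ≠ label l r j k → v ≠ label l r j (k + 1) → N (j + 1) v = N j v) ∧
      (N (j + 1) (label l r j k) + N j (label l r j k) =
        N (j + 1) (label l r j (k + 1)) + N j (label l r j (k + 1)) ∨
        (N j (label l r j k) = 1 ∧ N (j + 1) (label l r j k) = 1) ∨
        (N j (label l r j (k + 1)) = 1 ∧ N (j + 1) (label l r j (k + 1)) = 1))) :
    RulingPath (2 * w g) (((l.drop g).take d).flatMap (Event.copy 2))
      (double (r g) (strandState l w r N g)) (double (r (g + d)) (strandState l w r N (g + d))) := by
  induction d with
  | zero =>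
    refine .refl ?_
    exact (H.isPairing g hd).double (H.strandState_companion N hd) (strandState_of_le N g)
  | succ d ih =>
    rw [List.take_succ_eq_append_getElem (by rw [List.length_drop]; omega), List.flatMap_append]
    refine (ih (by omega) (fun j k h1 h2 => hleft j k h1 (by omega))
      (fun j k h1 h2 => hright j k h1 (by omega)) (fun j v h1 h2 => hsame j v h1 (by omega))
      (fun j k h1 h2 => hswitch j k h1 (by omega))).append
      ((H.isTangle_segment g d (by omega)).copy 2).strandsAfter_eq ?_
    have := H.rulingPath_copy (j := g + d) N (by omega) (fun k => hleft _ k (by omega) (by omega))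
      (fun k => hright _ k (by omega) (by omega)) (fun v => hsame _ v (by omega) (by omega))
      (fun k => hswitch _ k (by omega) (by omega))
    simpa [← add_assoc] using this

end Ruled

/-! ### Connectedness of the graph of disks and switches -/

/-- The disks beginning at the left cusps `x` and `y` meet at a switch. -/
def SwitchAdj (l : List Event) (r : ℕ → ℕ → ℕ) (x y : ℕ) : Prop :=
  ∃ j k, l[j]? = some (crossing k) ∧ r j = r (j + 1) ∧ label l r j k = x ∧ label l r j (k + 1) = y

/-- The knot always runs straight through a crossing. It stays in its disk if the ruling follows the
crossing, and passes to the adjacent disk at a switch. -/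
theorem eqvGen_label_swap {l : List Event} {r : ℕ → ℕ → ℕ} {j k : ℕ}
    (h : l[j]? = some (crossing k)) (i : ℕ) :
    Relation.EqvGen (SwitchAdj l r) (label l r j i)
      (label l r (j + 1) (Equiv.swap k (k + 1) i)) := by
  by_cases hr : r j = r (j + 1)
  · rw [label_switch h hr]
    by_cases h1 : i = k
    · rw [h1, Equiv.swap_apply_left]
      exact .rel _ _ ⟨j, k, h, hr, rfl, rfl⟩
    by_cases h2 : i = k + 1
    · rw [h2, Equiv.swap_apply_right]
      exact .symm _ _ (.rel _ _ ⟨j, k, h, hr, rfl, rfl⟩)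
    rw [Equiv.swap_apply_of_ne_of_ne h1 h2]
    exact .refl _
  · rw [label_followed h hr]
    exact .refl _

theorem getElem?_eq_some_of_eq {l : List Event} {j : ℕ} {e : Event} (hj : j < l.length)
    (he : l[j] = e) : l[j]? = some e := List.getElem?_eq_some_iff.2 ⟨hj, he⟩

/-- The members of a finite closed cover of a connected space are equivalent if any two which meet
are. -/
theorem rel_of_isClosed_cover {X ι : Type*} [TopologicalSpace X] [PreconnectedSpace X] [Finite ι]
    {A : ι → Set X} (hA : ∀ i, IsClosed (A i)) (hne : ∀ i, (A i).Nonempty)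
    (hcover : ∀ x, ∃ i, x ∈ A i) {R : ι → ι → Prop} (hR : Equivalence R)
    (h : ∀ i j, (A i ∩ A j).Nonempty → R i j) (i j : ι) : R i j := by
  by_contra hcon
  have hclosed : ∀ Q : ι → Prop, IsClosed (⋃ k ∈ {k | Q k}, A k) := fun Q =>
    Set.Finite.isClosed_biUnion (Set.toFinite _) fun k _ => hA k
  obtain ⟨x, -, hx1, hx2⟩ := isPreconnected_closed_iff.1 (isPreconnected_univ (α := X))
    _ _ (hclosed fun k => R i k) (hclosed fun k => ¬ R i k) (fun x _ => by
      obtain ⟨k, hk⟩ := hcover x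
      by_cases hQ : R i k
      · exact Or.inl (Set.mem_biUnion hQ hk)
      · exact Or.inr (Set.mem_biUnion hQ hk))
    ((hne i).mono fun x hx => ⟨trivial, Set.mem_biUnion (hR.refl i) hx⟩)
    ((hne j).mono fun x hx => ⟨trivial, Set.mem_biUnion hcon hx⟩)
  obtain ⟨k, hk, hxk⟩ := Set.mem_iUnion₂.1 hx1
  obtain ⟨k', hk', hxk'⟩ := Set.mem_iUnion₂.1 hx2
  exact hk' (hR.trans hk (h k k' ⟨x, hxk, hxk'⟩))

/-- The front of `K` is cut into the strands of `F`, over the intervals between the points `c j`;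
the `i`-th strand over `[c g, c (g + 1)]` is parametrized by `s (g + 1) i`. -/
structure IsCut (K : LegendrianKnot) (F : Front 0) (c : ℕ → ℝ)
    (s : ℕ → ℕ → ℝ → UnitAddCircle) : Prop where
  lt_succ : ∀ g, g + 1 < F.events.length → c g < c (g + 1)
  isSection : ∀ g i, g + 1 < F.events.length → i < F.width (g + 1) →
    ContinuousOn (s (g + 1) i) (Set.Icc (c g) (c (g + 1))) ∧
      ∀ ξ ∈ Set.Icc (c g) (c (g + 1)), K.x (s (g + 1) i ξ) = ξ
  covers : ∀ t, ∃ g i, g + 1 < F.events.length ∧ i < F.width (g + 1) ∧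
    ∃ ξ ∈ Set.Icc (c g) (c (g + 1)), s (g + 1) i ξ = t
  ordered : ∀ (g i i' : ℕ) (hg : g + 1 < F.events.length), i < i' → i' < F.width (g + 1) →
    ∀ ξ ∈ Set.Icc (c g) (c (g + 1)),
      K.z (s (g + 1) i' ξ) < K.z (s (g + 1) i ξ) ∨
      (ξ = c g ∧ i' = i + 1 ∧ (F.events[g]).MeetsRight i) ∨
      (ξ = c (g + 1) ∧ i' = i + 1 ∧ (F.events[g + 1]).MeetsLeft i)
  joined : ∀ (j : ℕ) (hj : j < F.events.length),
    (F.events[j]).Joins (F.width j) (fun i => s j i (c j)) (fun i => s (j + 1) i (c j))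

namespace IsCut

variable {K : LegendrianKnot} {F : Front 0} {c : ℕ → ℝ} {s : ℕ → ℕ → ℝ → UnitAddCircle}
  (hK : IsCut K F c s) {r : ℕ → ℕ → ℕ} (H : Ruled F.events F.width r) {g g' i i' : ℕ} {ξ : ℝ}

include hK

theorem lt_of_lt {a b : ℕ} (hab : a < b) (hb : b < F.events.length) : c a < c b := by
  induction b, hab using Nat.le_induction with
  | base => exact hK.lt_succ a hb
  | succ b _ ih => exact (ih (by omega)).trans (hK.lt_succ b hb)

include H

/-- Strands over the same interval can share a point of the knot only at a cusp, where they are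
companions; at a crossing the two parameters differ. -/
theorem label_eq_of_lt (hg : g + 1 < F.events.length) (hii : i < i') (hi' : i' < F.width (g + 1))
    (hξ : ξ ∈ Set.Icc (c g) (c (g + 1))) (heq : s (g + 1) i ξ = s (g + 1) i' ξ) :
    label F.events r (g + 1) i = label F.events r (g + 1) i' := by
  rcases hK.ordered g i i' hg hii hi' ξ hξ with h | ⟨rfl, rfl, h⟩ | ⟨rfl, rfl, h⟩
  · rw [heq] at h
    exact absurd h (lt_irrefl _)
  · rcases h with h | h
    · have h' := getElem?_eq_some_of_eq _ h
      rw [label_leftCusp_self h', label_leftCusp_succ h']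
    · exfalso
      have h1 := hK.joined g (by omega)
      have h2 := H.fits g (by omega)
      rw [h] at h1 h2
      simp only [Fits] at h2
      refine h1.1 ?_
      have e1 := h1.2 i (by omega)
      have e2 := h1.2 (i + 1) (by omega)
      rw [Equiv.swap_apply_left] at e1
      rw [Equiv.swap_apply_right] at e2
      exact e1.trans (heq.symm.trans e2.symm)
  · rcases h with h | h
    · obtain ⟨-, -, -, h1, -⟩ := H.rightCusp_data (getElem?_eq_some_of_eq _ h)
      rw [← h1, H.label_companion hg.le]
    · exfalso
      have h1 := hK.joined (g + 1) hg
      rw [h] at h1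
      exact h1.1 heq

theorem label_eq (hg : g + 1 < F.events.length) (hi : i < F.width (g + 1))
    (hi' : i' < F.width (g + 1)) (hξ : ξ ∈ Set.Icc (c g) (c (g + 1)))
    (heq : s (g + 1) i ξ = s (g + 1) i' ξ) :
    label F.events r (g + 1) i = label F.events r (g + 1) i' := by
  rcases lt_trichotomy i i' with h | h | h
  · exact hK.label_eq_of_lt H hg h hi' hξ heq
  · rw [h]
  · exact (hK.label_eq_of_lt H hg h hi hξ heq.symm).symm

theorem eqvGen_succ (hg : g + 2 < F.events.length) (hi : i < F.width (g + 1))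
    (hi' : i' < F.width (g + 2)) (heq : s (g + 1) i (c (g + 1)) = s (g + 2) i' (c (g + 1))) :
    Relation.EqvGen (SwitchAdj F.events r) (label F.events r (g + 1) i)
      (label F.events r (g + 2) i') := by
  have hg1 : g + 1 < F.events.length := by omega
  have hj := hK.joined (g + 1) hg1
  have m1 : c (g + 1) ∈ Set.Icc (c g) (c (g + 1)) := ⟨(hK.lt_succ g hg1).le, le_rfl⟩
  have m2 : c (g + 1) ∈ Set.Icc (c (g + 1)) (c (g + 1 + 1)) := ⟨le_rfl, (hK.lt_succ (g + 1) hg).le⟩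
  rcases he : F.events[g + 1] with k | k | k <;> rw [he] at hj <;>
    have he' := getElem?_eq_some_of_eq hg1 he
  · obtain ⟨-, h1, h2, -⟩ := H.leftCusp_data he'
    rw [← label_leftCusp_skip he', hK.label_eq H hg (by rw [h2, skip_lt_iff h1]; exact hi) hi' m2
      ((hj.2 i hi).symm.trans heq)]
    exact .refl _
  · obtain ⟨-, h1, h2, -⟩ := H.rightCusp_data he'
    have h3 : skip k i' < F.width (g + 1) := by rw [h2, skip_lt_iff h1]; exact hi'
    rw [label_rightCusp he', hK.label_eq H (i' := skip k i') hg1 hi h3 m1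
      (heq.trans (hj.2 i' (by rw [h2]; exact Nat.add_lt_add_right hi' 2)).symm)]
    exact .refl _
  · obtain ⟨-, h1, h2, -⟩ := H.crossing_data he'
    rw [← hK.label_eq H (i := Equiv.swap k (k + 1) i) hg (by rw [h2]; exact swap_succ_lt h1 hi) hi'
      m2 ((hj.2 i hi).symm.trans heq)]
    exact eqvGen_label_swap he' i

theorem eqvGen_of_lt (hgg : g < g') (hg' : g' + 1 < F.events.length)
    (hi : i < F.width (g + 1)) (hi' : i' < F.width (g' + 1))
    (hξ : ξ ∈ Set.Icc (c g) (c (g + 1))) (hξ' : ξ ∈ Set.Icc (c g') (c (g' + 1)))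
    (heq : s (g + 1) i ξ = s (g' + 1) i' ξ) :
    Relation.EqvGen (SwitchAdj F.events r) (label F.events r (g + 1) i)
      (label F.events r (g' + 1) i') := by
  obtain rfl : g' = g + 1 := by
    by_contra hne
    have := hK.lt_of_lt (a := g + 1) (b := g') (by omega) (by omega)
    linarith [hξ.2, hξ'.1]
  obtain rfl : ξ = c (g + 1) := le_antisymm hξ.2 hξ'.1
  exact hK.eqvGen_succ H hg' hi hi' heq

theorem eqvGen_of_eq (hg : g + 1 < F.events.length) (hg' : g' + 1 < F.events.length)
    (hi : i < F.width (g + 1)) (hi' : i' < F.width (g' + 1))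
    (hξ : ξ ∈ Set.Icc (c g) (c (g + 1))) (hξ' : ξ ∈ Set.Icc (c g') (c (g' + 1)))
    (heq : s (g + 1) i ξ = s (g' + 1) i' ξ) :
    Relation.EqvGen (SwitchAdj F.events r) (label F.events r (g + 1) i)
      (label F.events r (g' + 1) i') := by
  rcases lt_trichotomy g g' with h | rfl | h
  · exact hK.eqvGen_of_lt H h hg' hi hi' hξ hξ' heq
  · rw [hK.label_eq H hg hi hi' hξ heq]
    exact .refl _
  · exact .symm _ _ (hK.eqvGen_of_lt H h hg hi' hi hξ' hξ heq.symm)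

end IsCut

/-- The strands are finitely many closed arcs covering the circle, and arcs that meet lie in
equivalent disks. Connectedness of the circle gives the claim; this is where it matters that `K` is
a knot rather than a link. -/
theorem Ruled.eqvGen_switchAdj {K : LegendrianKnot} {F : Front 0} (hF : K.HasFront F)
    {r : ℕ → ℕ → ℕ} (H : Ruled F.events F.width r) {g g' i i' : ℕ} (hg : g ≤ F.events.length)
    (hi : i < F.width g) (hg' : g' ≤ F.events.length) (hi' : i' < F.width g') :
    Relation.EqvGen (SwitchAdj F.events r) (label F.events r g i) (label F.events r g' i') := by
  obtain ⟨-, c, s, h1, h2, h3, h4, h5⟩ := hF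
  have hK : IsCut K F c s := ⟨h1, h2, h3, h4, h5⟩
  have hgap : ∀ {g i}, g ≤ F.events.length → i < F.width g →
      ∃ h, g = h + 1 ∧ h + 1 < F.events.length := by
    intro g i hg hi
    rcases g with _ | h
    · rw [H.width_zero] at hi; omega
    · refine ⟨h, rfl, lt_of_le_of_ne hg fun h1 => ?_⟩
      rw [h1, H.width_length] at hi
      omega
  obtain ⟨g, rfl, hg⟩ := hgap hg hi
  obtain ⟨g', rfl, hg'⟩ := hgap hg' hi'
  let ι := Σ g : Fin (F.events.length - 1), Fin (F.width (g + 1))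
  have hι : ∀ k : ι, (k.1 : ℕ) + 1 < F.events.length := fun k => by have := k.1.2; omega
  refine rel_of_isClosed_cover (ι := ι)
    (A := fun k => s (k.1 + 1) k.2 '' Set.Icc (c k.1) (c (k.1 + 1)))
    (R := fun k k' => Relation.EqvGen (SwitchAdj F.events r) (label F.events r (k.1 + 1) k.2)
      (label F.events r (k'.1 + 1) k'.2))
    (fun k => (isCompact_Icc.image_of_continuousOn (h2 _ _ (hι k) k.2.2).1).isClosed)
    (fun k => ⟨_, _, ⟨le_rfl, (h1 _ (hι k)).le⟩, rfl⟩)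
    (fun t => by
      obtain ⟨g, i, hg, hi, h⟩ := h3 t
      exact ⟨⟨⟨g, by omega⟩, ⟨i, hi⟩⟩, h⟩)
    ⟨fun _ => .refl _, fun h => .symm _ _ h, fun h h' => .trans _ _ _ h h'⟩ ?_
    ⟨⟨g, by omega⟩, ⟨i, hi⟩⟩ ⟨⟨g', by omega⟩, ⟨i', hi'⟩⟩
  rintro k k' ⟨t, ⟨ξ, hξ, rfl⟩, ⟨ξ', hξ', heq⟩⟩
  -- A common point has a single `x`-coordinate, and strands are sections over `x`.
  obtain rfl : ξ' = ξ := by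
    rw [← (h2 _ _ (hι k) k.2.2).2 ξ hξ, ← (h2 _ _ (hι k') k'.2.2).2 ξ' hξ', heq]
  exact hK.eqvGen_of_eq H (hι k) (hι k') k.2.2 k'.2.2 hξ hξ' heq.symm

/-! ### Ruling polynomials and counts of cusps -/

namespace Front

variable {n : ℕ} (F : Front n)

theorem coeff_rulingPolynomial (d : ℤ) : F.rulingPolynomial.coeff d =
    ∑ ρ ∈ F.finite_normalRulings.toFinset,
      if (F.switches ρ : ℤ) - (F.rightCusps : ℤ) = d then 1 else 0 := by
  rw [rulingPolynomial, AddMonoidAlgebra.coeff_sum, Finset.sum_apply']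
  refine Finset.sum_congr rfl fun ρ _ => ?_
  rw [LaurentPolynomial.T, AddMonoidAlgebra.coeff_single, Finsupp.single_apply]

theorem exists_isNormalRuling_of_degree_nonneg (h : 0 ≤ F.rulingPolynomial.degree) :
    ∃ ρ, F.IsNormalRuling ρ ∧ F.rightCusps ≤ F.switches ρ := by
  rw [LaurentPolynomial.degree] at h
  rcases hm : F.rulingPolynomial.coeff.support.max with _ | d
  · rw [hm] at h
    exact absurd (WithBot.le_bot_iff.1 h) (by simp)
  · have h1 := Finset.mem_of_max hm
    rw [hm] at h
    have h2 : 0 ≤ d := WithBot.coe_le_coe.1 h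
    rw [Finsupp.mem_support_iff, coeff_rulingPolynomial] at h1
    obtain ⟨ρ, hρ, h3⟩ := Finset.exists_ne_zero_of_sum_ne_zero h1
    refine ⟨ρ, by simpa using hρ, ?_⟩
    have h4 : (F.switches ρ : ℤ) - (F.rightCusps : ℤ) = d := by
      by_contra h4
      exact h3 (if_neg h4)
    omega

/-- Coefficients are numbers of rulings, so nothing cancels. -/
theorem rulingPolynomial_ne_zero {ρ : Fin (F.events.length + 1) → ℕ → ℕ}
    (h : F.IsNormalRuling ρ) : F.rulingPolynomial ≠ 0 := by
  intro h0
  have h1 := F.coeff_rulingPolynomial ((F.switches ρ : ℤ) - (F.rightCusps : ℤ))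
  rw [h0, AddMonoidAlgebra.coeff_zero, Finsupp.zero_apply] at h1
  have h2 := (Finset.sum_eq_zero_iff_of_nonneg (fun _ _ => by split_ifs <;> norm_num)).1 h1.symm ρ
    (by simpa using h)
  simp at h2

theorem rulingPolynomial_basicFront_two : (basicFront 2).rulingPolynomial = 0 := by
  refine Finset.sum_eq_zero fun ρ hρ => ?_
  exfalso
  obtain ⟨h1, h2, -⟩ : (basicFront 2).IsNormalRuling ρ := by simpa using hρ
  have h3 : ρ 0 0 ≠ 1 := (h2 ⟨0, by decide⟩).1
  have h4 : ρ 0 0 < 2 ∧ ρ 0 0 ≠ 0 ∧ _ := (h1 0).1 0 (by decide)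
  omega

end Front

theorem natCard_fin_subtype {n : ℕ} (P : Fin n → Prop) (Q : ℕ → Prop) [DecidablePred Q]
    (h : ∀ j, P j ↔ Q j) : Nat.card {j : Fin n // P j} = ((Finset.range n).filter Q).card := by
  classical
  rw [Nat.card_eq_fintype_card, Fintype.card_subtype, ← Finset.card_map Fin.valEmbedding]
  congr 1
  ext j
  simp only [Finset.mem_map, Finset.mem_filter, Finset.mem_univ, true_and, Fin.valEmbedding_apply,
    Finset.mem_range]
  constructor
  · rintro ⟨j, hj, rfl⟩
    exact ⟨j.2, (h j).1 hj⟩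
  · rintro ⟨h1, h2⟩
    exact ⟨⟨j, h1⟩, (h _).2 h2, rfl⟩

open Classical in
-- Left cusps add two strands, right cusps remove two, and there are none at either end.
theorem Ruled.card_cusps {l : List Event} {w : ℕ → ℕ} {r : ℕ → ℕ → ℕ} (H : Ruled l w r) :
    ((Finset.range l.length).filter fun j => ∃ k, l[j]? = some (leftCusp k)).card =
      ((Finset.range l.length).filter fun j => ∃ k, l[j]? = some (rightCusp k)).card := by
  have key : ∀ g ≤ l.length,
      w g + 2 * ((Finset.range g).filter fun j => ∃ k, l[j]? = some (rightCusp k)).card =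
        2 * ((Finset.range g).filter fun j => ∃ k, l[j]? = some (leftCusp k)).card := by
    intro g hg
    induction g with
    | zero => simp [H.width_zero]
    | succ j ih =>
      have hj : j < l.length := hg
      have := ih hj.le
      rw [Finset.range_add_one, Finset.filter_insert, Finset.filter_insert]
      rcases he : l[j] with k | k | k <;>
        have he' : l[j]? = some _ := List.getElem?_eq_some_iff.2 ⟨hj, he⟩
      · have := (H.leftCusp_data he').2.2.1
        rw [if_neg (by simp [he']), if_pos ⟨k, he'⟩, Finset.card_insert_of_notMem (by simp)]
        omega
      · have := (H.rightCusp_data he').2.2.1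
        rw [if_pos ⟨k, he'⟩, if_neg (by simp [he']), Finset.card_insert_of_notMem (by simp)]
        omega
      · have := (H.crossing_data he').2.2.1
        rw [if_neg (by simp [he']), if_neg (by simp [he'])]
        omega
  have := key l.length le_rfl
  rw [H.width_length] at this
  omega

/-! ### Assembling the ruling of the satellite -/

/-- The pairings of a normal ruling, as a sequence. -/
def extendRuling {m : ℕ} (ρ : Fin (m + 1) → ℕ → ℕ) (g : ℕ) : ℕ → ℕ :=
  if h : g < m + 1 then ρ ⟨g, h⟩ else id

theorem extendRuling_of_le {m : ℕ} (ρ : Fin (m + 1) → ℕ → ℕ) {g : ℕ} (h : g ≤ m) :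
    extendRuling ρ g = ρ ⟨g, Nat.lt_succ_of_le h⟩ := dif_pos _

theorem Front.IsNormalRuling.ruled {F : Front 0} {ρ : Fin (F.events.length + 1) → ℕ → ℕ}
    (h : F.IsNormalRuling ρ) : Ruled F.events F.width (extendRuling ρ) where
  width_zero := by simp [Front.width, strandsAfter]
  width_length := by
    rw [Front.width, List.take_length]
    exact F.closed.strandsAfter_eq
  fits j hj := by
    have := (F.closed.split j).2
    rw [List.drop_eq_getElem_cons hj] at this
    exact this.1
  out j hj := by
    rw [Front.width, List.take_succ_eq_append_getElem hj, strandsAfter_append]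
    rfl
  isPairing g hg := by
    rw [extendRuling_of_le ρ hg]
    exact h.1 ⟨g, Nat.lt_succ_of_le hg⟩
  passes j hj := by
    rw [extendRuling_of_le ρ hj.le, extendRuling_of_le ρ hj]
    exact h.2.1 ⟨j, hj⟩

/-- A normal ruling of the satellite, from the states `N t` of the disks of a normal ruling of `F`:
`N (2 * g)` and `N (2 * g + 1)` are the states over the gap `g`, to the left and to the right of the
base point. -/
theorem rulingPath_satellite {F : Front 0} {r : ℕ → ℕ → ℕ} (H : Ruled F.events F.width r)
    (b : BasePoint F) (rightward : Bool) (N : ℕ → ℕ → ZMod 2)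
    (hE : ∀ t v, t ≠ 2 * b.gap → (∀ j k, t = 2 * j + 1 → F.events[j]? = some (crossing k) →
      r j = r (j + 1) → v ≠ label F.events r j k ∧ v ≠ label F.events r j (k + 1)) →
      N (t + 1) v = N t v)
    (hbase : ∀ v, v ≠ label F.events r b.gap b.strand → N (2 * b.gap + 1) v = N (2 * b.gap) v)
    (hbase' : N (2 * b.gap + 1) (label F.events r b.gap b.strand) =
        N (2 * b.gap) (label F.events r b.gap b.strand) + 1 ∨
      (N (2 * b.gap) (label F.events r b.gap b.strand) = 1 ∧
        N (2 * b.gap + 1) (label F.events r b.gap b.strand) = 1))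
    (hswitch : ∀ j k, F.events[j]? = some (crossing k) → r j = r (j + 1) →
      N (2 * j + 1 + 1) (label F.events r j k) + N (2 * j + 1) (label F.events r j k) =
        N (2 * j + 1 + 1) (label F.events r j (k + 1)) +
          N (2 * j + 1) (label F.events r j (k + 1)) ∨
        (N (2 * j + 1) (label F.events r j k) = 1 ∧
          N (2 * j + 1 + 1) (label F.events r j k) = 1) ∨
        (N (2 * j + 1) (label F.events r j (k + 1)) = 1 ∧
          N (2 * j + 1 + 1) (label F.events r j (k + 1)) = 1))
    (h0 : ∀ v, N 0 v = 0) (hend : ∀ v, N (2 * F.events.length + 1) v = 0) :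
    RulingPath 0 (satellite F b rightward (basicFront 2)).events id id := by
  have hD := H.label_lt b.gap_le b.strand_lt
  -- a label has state 0 before its disk begins and after it ends
  have hbefore : ∀ j k t, F.events[j]? = some (leftCusp k) → t ≤ 2 * j + 2 ∨ (t ≤ 2 * j + 3 ∧ b.gap ≤ j) →
      N t j = 0 := by
    intro j k t hj ht
    induction t with
    | zero => exact h0 j
    | succ t ih =>
      rw [← ih (by omega)]
      by_cases hb : t = 2 * b.gap
      · subst hb
        exact hbase j (by omega)
      · refine hE t j hb fun i k' hi hc _ => ?_
        obtain ⟨h1, h2, -⟩ := H.crossing_data hc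
        have h3 := (H.label_lt h1.le (i := k') (by omega)).1
        have h4 := (H.label_lt h1.le (i := k' + 1) (by omega)).1
        omega
  have hafter : ∀ j k t, F.events[j]? = some (rightCusp k) → 2 * j ≤ t → (j < b.gap ∨ 2 * b.gap < t) →
      t ≤ 2 * F.events.length + 1 → N t (label F.events r j k) = 0 := by
    intro j k t hj ht hb htl
    induction htl using Nat.decreasingInduction with
    | self => exact hend _
    | of_succ t htl ih =>
      rw [← ih (by omega) (by omega)]
      symm
      by_cases hbt : t = 2 * b.gap
      · subst hbt
        exact hbase _ (H.label_ne_of_rightCusp hj (by omega) b.gap_le b.strand_lt).symm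
      · refine hE t _ hbt fun i k' hi hc _ => ?_
        obtain ⟨h1, h2, -⟩ := H.crossing_data hc
        have : i ≠ j := by
          rintro rfl
          rw [hc] at hj
          simp at hj
        exact ⟨(H.label_ne_of_rightCusp hj (by omega) h1.le (by omega)).symm,
          (H.label_ne_of_rightCusp hj (by omega) h1.le (by omega)).symm⟩
  have hstep : ∀ t v, t ≠ b.gap → N (2 * t + 1) v = N (2 * t) v := fun t v ht =>
    hE _ v (by omega) fun j k hj => by omega
  have hstep' : ∀ j v, ¬ ((∃ k, F.events[j]? = some (crossing k)) ∧ r j = r (j + 1)) →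
      N (2 * j + 1 + 1) v = N (2 * j + 1) v := fun j v hj =>
    hE _ v (by omega) fun i k hi hc hr => absurd ⟨⟨k, by
      rwa [show i = j by omega] at hc⟩, by rwa [show i = j by omega] at hr⟩ hj
  have hstep'' : ∀ j k, F.events[j]? = some (crossing k) → ∀ v, v ≠ label F.events r j k →
      v ≠ label F.events r j (k + 1) → N (2 * j + 1 + 1) v = N (2 * j + 1) v := fun j k hj v h1 h2 =>
    hE _ v (by omega) fun i k' hi hc hr => by
      obtain rfl : i = j := by omega
      rw [hj] at hc
      simp only [Option.some.injEq, crossing.injEq] at hc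
      subst hc
      exact ⟨h1, h2⟩
  -- Left of the base point the states are those with even index; to its right, in `path2`, those
  -- with odd index.
  have path1 := H.rulingPath_segment (fun g => N (2 * g)) 0 b.gap (by have := b.gap_le; omega)
    (fun j k _ _ hj => hbefore j k _ hj (by omega))
    (fun j k _ h hj => hafter j k _ hj (by omega) (by omega) (by have := b.gap_le; omega))
    (fun j v _ h hj => by
      change N (2 * j + 1 + 1) v = _
      rw [hstep' j v hj, hstep j v (by omega)])
    (fun j k _ h hj hr => by
      refine ⟨fun v h1 h2 => ?_, ?_⟩
      · change N (2 * j + 1 + 1) v = _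
        rw [hstep'' j k hj v h1 h2, hstep j v (by omega)]
      · have := hswitch j k hj hr
        rwa [hstep j _ (by omega), hstep j _ (by omega)] at this)
  have path2 := H.rulingPath_segment (fun g => N (2 * g + 1)) b.gap (F.events.length - b.gap)
    (by have := b.gap_le; omega)
    (fun j k h _ hj => hbefore j k _ hj (by omega))
    (fun j k h _ hj => hafter j k _ hj (by omega) (by omega) (by omega))
    (fun j v h _ hj => by
      rw [hstep (j + 1) v (by omega), ← hstep' j v hj, mul_add])
    (fun j k h _ hj hr => by
      refine ⟨fun v h1 h2 => ?_, ?_⟩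
      · rw [hstep (j + 1) v (by omega), ← hstep'' j k hj v h1 h2, mul_add]
      · have := hswitch j k hj hr
        change N (2 * (j + 1) + 1) _ + _ = N (2 * (j + 1) + 1) _ + _ ∨
          _ ∧ N (2 * (j + 1) + 1) _ = 1 ∨ _ ∧ N (2 * (j + 1) + 1) _ = 1
        rwa [hstep (j + 1) _ (by omega), hstep (j + 1) _ (by omega)])
  have hgl : b.gap ≤ F.events.length := b.gap_le
  rw [show b.gap + (F.events.length - b.gap) = F.events.length by omega] at path2
  have hs := H.strandState_companion (fun g => N (2 * g)) hgl
  have hs' := H.strandState_companion (fun g => N (2 * g + 1)) hgl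
  have path3 := rulingPath_base (H.isPairing b.gap hgl) hs (strandState_of_le _ _) b.strand_lt
    hs' (fun i h1 h2 => by
      by_cases hi : i < F.width b.gap
      · rw [strandState, strandState, if_pos hi, if_pos hi]
        refine hbase _ fun h => ?_
        rcases H.eq_of_label_eq hgl b.strand_lt hi h.symm with h | h
        · exact h1 h
        · exact h2 h
      · rw [strandState, strandState, if_neg hi, if_neg hi])
    (by
      rw [strandState, strandState, if_pos b.strand_lt, if_pos b.strand_lt]
      exact hbase')
  have hdouble : ∀ g, g ≤ F.events.length → F.width g = 0 → ∀ M : ℕ → ℕ → ZMod 2,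
      double (r g) (strandState F.events F.width r M g) = id := by
    intro g hg hw M
    have := (H.isPairing g hg).double (H.strandState_companion M hg) (strandState_of_le M g)
    funext i
    exact this.2 i (by omega)
  rw [hdouble 0 (by omega) H.width_zero, H.width_zero] at path1
  rw [hdouble _ le_rfl H.width_length] at path2
  rw [zero_add] at path1
  have hins : (insertedEvents (basicFront 2) rightward).map (Event.shift (2 * b.strand)) =
      [crossing (2 * b.strand)] := by
    cases rightward <;> simp [insertedEvents, basicFront, Event.shift, Event.reflect]
  change RulingPath 0 (_ ++ (insertedEvents (basicFront 2) rightward).map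
    (Event.shift (2 * b.strand)) ++ _) id id
  rw [hins]
  rw [List.drop_zero] at path1
  rw [← List.length_drop, List.take_length] at path2
  refine (path1.append ?_ path3).append ?_ path2
  · exact ((F.closed.split b.gap).1.copy 2).strandsAfter_eq
  · rw [strandsAfter_append]
    exact ((F.closed.split b.gap).1.copy 2).strandsAfter_eq

end LegendrianFront

/-- If a Legendrian knot `K` in `ℝ³` with generic front `F` has ungraded ruling polynomial of degree
at least `0`, then it is compatible with the basic front `A₂`, for every choice of the base point
and of the orientation. -/
theorem mainTheorem12 (K : LegendrianFront.LegendrianKnot) (F : LegendrianFront.Front 0)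
    (hF : K.HasFront F) (hdeg : 0 ≤ F.rulingPolynomial.degree)
    (b : LegendrianFront.BasePoint F) (rightward : Bool) :
    LegendrianFront.IsCompatible F b rightward (LegendrianFront.basicFront 2) := by
  classical
  open LegendrianFront Event in
  obtain ⟨ρ, hρ, hcard⟩ := F.exists_isNormalRuling_of_degree_nonneg hdeg
  let r := extendRuling ρ
  have H : Ruled F.events F.width r := hρ.ruled
  let isSwitch : ℕ → Prop := fun j => (∃ k, F.events[j]? = some (crossing k)) ∧ r j = r (j + 1)
  let place : ℕ → ℕ := fun j => match F.events[j]? with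
    | some (crossing k) => k
    | _ => 0
  have hplace : ∀ j k, F.events[j]? = some (crossing k) → place j = k := fun j k h => by
    simp only [place, h]
  let V := (Finset.range F.events.length).filter fun j => ∃ k, F.events[j]? = some (leftCusp k)
  -- The switch `j` occurs at time `2 * j + 1` and the inserted crossing at time `2 * b.gap`, so
  -- times are distinct and ordered from left to right.
  let E := ((Finset.range F.events.length).filter isSwitch).image fun j => 2 * j + 1
  let a : ℕ → ℕ := fun t => label F.events r (t / 2) (place (t / 2))
  let c : ℕ → ℕ := fun t => label F.events r (t / 2) (place (t / 2) + 1)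
  have hdiv : ∀ j, (2 * j + 1) / 2 = j := fun j => by omega
  have hmemE : ∀ j k, F.events[j]? = some (crossing k) → r j = r (j + 1) → 2 * j + 1 ∈ E ∧
      a (2 * j + 1) = label F.events r j k ∧ c (2 * j + 1) = label F.events r j (k + 1) := by
    intro j k h1 h2
    refine ⟨Finset.mem_image.2 ⟨j, Finset.mem_filter.2 ⟨Finset.mem_range.2
      (H.crossing_data h1).1, ⟨k, h1⟩, h2⟩, rfl⟩, ?_, ?_⟩
    · simp only [a, hdiv, hplace j k h1]
    · simp only [c, hdiv, hplace j k h1]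
  have hofE : ∀ t ∈ E, ∃ j k, t = 2 * j + 1 ∧ F.events[j]? = some (crossing k) ∧ r j = r (j + 1) := by
    intro t ht
    obtain ⟨j, hj, rfl⟩ := Finset.mem_image.1 ht
    obtain ⟨-, ⟨k, h1⟩, h2⟩ := Finset.mem_filter.1 hj
    exact ⟨j, k, rfl, h1, h2⟩
  have hlabel : ∀ g i, g ≤ F.events.length → i < F.width g → label F.events r g i ∈ V := by
    intro g i hg hi
    obtain ⟨h1, h2⟩ := H.label_lt hg hi
    exact Finset.mem_filter.2 ⟨Finset.mem_range.2 (by omega), h2⟩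
  -- Disks are counted by left cusps, whereas the degree hypothesis bounds right cusps.
  have hV : V.card ≤ E.card := by
    rw [Finset.card_image_of_injective _ fun i j h => by simpa using h, H.card_cusps]
    rw [Front.rightCusps, Front.switches, natCard_fin_subtype _ (fun j => ∃ k, F.events[j]? = some
      (rightCusp k)) fun j => by simp, natCard_fin_subtype _ isSwitch fun j => ?_] at hcard
    · exact hcard
    · simp only [isSwitch, r]
      rw [extendRuling_of_le ρ j.2.le, extendRuling_of_le ρ j.2, List.getElem?_eq_getElem j.2]
      simp only [Option.some.injEq]
      rfl
  obtain ⟨N, h0, hend, hsame, hsame', hsw, hb, hb'⟩ := exists_states (E := E) (a := a) (b := c) V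
    (fun t ht => by
      obtain ⟨j, k, rfl, h1, h2⟩ := hofE t ht
      have := H.crossing_data h1
      rw [(hmemE j k h1 h2).2.1]
      exact hlabel _ _ this.1.le (by omega))
    (fun t ht => by
      obtain ⟨j, k, rfl, h1, h2⟩ := hofE t ht
      have := H.crossing_data h1
      rw [(hmemE j k h1 h2).2.2]
      exact hlabel _ _ this.1.le (by omega))
    -- A switch joins two different disks: otherwise its crossing strands would be companions.
    (fun t ht heq => by
      obtain ⟨j, k, rfl, h1, h2⟩ := hofE t ht
      obtain ⟨h3, h4, -, h5, -⟩ := H.crossing_data h1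
      rw [(hmemE j k h1 h2).2.1, (hmemE j k h1 h2).2.2] at heq
      rcases H.eq_of_label_eq h3.le (by omega) (by omega) heq with h | h
      · omega
      · exact h5 h.symm)
    hV (D := label F.events r b.gap b.strand) (t₀ := 2 * b.gap) (hlabel _ _ b.gap_le b.strand_lt)
    (fun h => by
      obtain ⟨j, k, h1, -⟩ := hofE _ h
      omega)
    (fun v hv => by
      obtain ⟨-, k, hk⟩ := Finset.mem_filter.1 hv
      obtain ⟨h1, h2, h3, -⟩ := H.leftCusp_data hk
      have := H.eqvGen_switchAdj hF b.gap_le b.strand_lt (g' := v + 1) (i' := k) h1 (by omega)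
      rw [label_leftCusp_self hk] at this
      refine this.mono fun x y ⟨j, k, h1, h2, h3, h4⟩ => ?_
      obtain ⟨h5, h6, h7⟩ := hmemE j k h1 h2
      exact ⟨_, h5, h6.trans h3, h7.trans h4⟩)
  have hpath := rulingPath_satellite H b rightward N (fun t v h1 h2 => by
      by_cases ht : t ∈ E
      · obtain ⟨j, k, rfl, h3, h4⟩ := hofE t ht
        have h5 := h2 j k rfl h3 h4
        refine hsame' _ ht v ?_ ?_
        · rw [(hmemE j k h3 h4).2.1]; exact h5.1
        · rw [(hmemE j k h3 h4).2.2]; exact h5.2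
      · exact hsame t v (by simp [h1, ht]))
    hb hb' (fun j k h1 h2 => by
      obtain ⟨h3, h4, h5⟩ := hmemE j k h1 h2
      have := hsw _ h3
      rwa [h4, h5] at this)
    h0 (fun v => hend _ v fun t ht => by
      rcases Finset.mem_insert.1 ht with rfl | h
      · have := b.gap_le
        omega
      · obtain ⟨j, k, rfl, h1, -⟩ := hofE t h
        have := (H.crossing_data h1).1
        omega)
  obtain ⟨σ, hσ⟩ := Front.exists_isNormalRuling _ hpath
  rw [IsCompatible, Front.rulingPolynomial_basicFront_two]
  exact Front.rulingPolynomial_ne_zero _ hσ
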